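/- Let $k$ be a commutative ring and $A$ a unital associative $k$-algebra; tensor products are over $k$. Let $\Delta S$ be the category with objects $[n]=\{0,\dots,n\}$, $n\ge 0$, in which a morphism $[n]\to[m]$ is a set map together with a total order on each of its fibres, equivalently a tensor $w_0\otimes\cdots\otimes w_m$ of monomials in noncommuting letters $z_0,\dots,z_n$ in which every letter occurs exactly once altogether; composition is substitution. Let $B^{sym}A:\Delta S\to k\text{-Mod}$ be the functor $[n]\mapsto A^{\otimes(n+1)}$, a morphism $w$ acting by $a_0\otimes\cdots\otimes a_n\mapsto w_0(a)\otimes\cdots\otimes w_m(a)$ (the empty monomial has value $1$). Symmetric homology is $HS_*(A)=\mathrm{Tor}^{\Delta S}_*(\underline{k},B^{sym}A)=H_*\big(k[N(-\setminus\Delta S)]\otimes_{\Delta S}B^{sym}A\big)$; explicitly, it is the homology of the complex whose $n$-chains are $\bigoplus_{X_0\to\cdots\to X_n}B^{sym}A(X_0)$, summed over the strings of $n$ composable morphisms of $\Delta S$, with the usual alternating sum of faces as differential. Consider the partial complex $$0\longleftarrow A\xleftarrow{\ \partial_1\ }A^{\otimes 3}\xleftarrow{\ \partial_2\ }A^{\otimes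 4}\oplus A,$$ $$\partial_1(a\otimes b\otimes c)=abc-cba,\qquad \partial_2(a)=1\otimes a\otimes 1,$$ $$\partial_2(a\otimes b\otimes c\otimes d)=ab\otimes c\otimes d+d\otimes ca\otimes b+bca\otimes 1\otimes d+d\otimes bc\otimes a.$$ Let $([A,A])$ be the two-sided ideal of $A$ generated by the commutators. The map sending $a\in A$ to the $0$-chain $a$ on the object $[0]$, and the map sending $x\otimes y\otimes z$ to the $1$-chain $(z_0z_1z_2,\ x\otimes y\otimes z)-(z_2z_1z_0,\ x\otimes y\otimes z)$ on the two indicated morphisms $[2]\to[0]$, induce $k$-linear isomorphisms $$A/([A,A])\cong HS_0(A),\qquad \ker\partial_1/\operatorname{im}\partial_2\cong HS_1(A).$$ Write $[c]\in HS_1(A)$ for the class that corresponds in this way to a cycle $c\in\ker\partial_1\subseteq A^{\otimes 3}$. For $a\in A$ let $\lambda_a,\rho_a:A^{\otimes3}\to A^{\otimes3}$ be the $k$-linear maps $$\lambda_a(x\otimes y\otimes z)=ax\otimes y\otimes z-x\otimes ya\otimes z+x\otimes y\otimes az,$$ $$\rho_a(x\otimes y\otimes z)=xa\otimes y\otimes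 z-x\otimes ay\otimes z+x\otimes y\otimes za.$$ Then $\lambda_a$ and $\rho_a$ map $\ker\partial_1$ into itself. Moreover $HS_1(A)$ is a left module over the $k$-algebra $HS_0(A)=A/([A,A])$ via $[a]\cdot[c]=[\lambda_a(c)]$, and a right module over it via $[c]\cdot[a]=[\rho_a(c)]$, for $a\in A$ and $c\in\ker\partial_1$ (both structures being compatible with the $k$-module structure of $HS_1(A)$), and the two actions are equal: $q\cdot h=h\cdot q$ for all $q\in A/([A,A])$ and $h\in HS_1(A)$. -/

import Mathlib

open CategoryTheory
open scoped TensorProduct DirectSum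

noncomputable section

namespace SymHom

/-! ### The category `ΔS` -/

/-- The objects `[n] = {0, 1, …, n}`, `n ≥ 0`, of the category `ΔS`. -/
@[ext] structure DeltaS where
  n : ℕ

/-- A morphism `[n] → [m]` of `ΔS` in tensor notation `w₀ ⊗ w₁ ⊗ ⋯ ⊗ w_m`: the `w_j` are monomials
in the noncommuting letters `z₀, …, z_n`, and every letter occurs exactly once in all. In other
words, it is a set map `[n] → [m]` (send `i` to the `j` for which `z_i` occurs in `w_j`) together
with a total order of each of its fibres (the order of the letters in `w_j`). Equivalently it is a
pair consisting of a permutation of `{0, …, n}` (read off from the concatenation `w₀w₁⋯w_m`) and a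
non-decreasing map `[n] → [m]` (whose fibres have sizes `|w₀|, …, |w_m|`). -/
@[ext] structure DeltaS.Hom (X Y : DeltaS) where
  word : Fin (Y.n + 1) → List (Fin (X.n + 1))
  once : ∀ i, ∑ j, (word j).count i = 1

theorem sum_map_eq_sum_count {α : Type*} [Fintype α] [DecidableEq α] (l : List α) (g : α → ℕ) :
    (l.map g).sum = ∑ j, l.count j * g j := by
  induction l with
  | nil => simp
  | cons a l ih =>
    simp [List.count_cons, add_mul, Finset.sum_add_distrib, ih, add_comm]

/-- Composition is substitution: in each monomial of the second morphism, the letter `z_j` is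
replaced by the `j`-th monomial of the first one. -/
instance : Category DeltaS where
  Hom := DeltaS.Hom
  id X := ⟨fun i => [i], fun i => by simp [List.count_singleton]⟩
  comp {X Y Z} f g := ⟨fun l => (g.word l).flatMap f.word, fun i => by
    simp only [List.count_flatMap, Function.comp_def]
    simp only [sum_map_eq_sum_count]
    rw [Finset.sum_comm]
    simp only [← Finset.sum_mul, g.once, one_mul, f.once]⟩
  id_comp f := by ext1; funext j; simp
  comp_id f := by ext1; funext j; simp
  assoc f g h := by ext1; funext j; simp [List.flatMap_assoc]

/-- The morphism `[n] → [m]` given by a list of `m + 1` monomials. -/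
def DeltaS.ofWord {n m : ℕ} (w : Fin (m + 1) → List (Fin (n + 1)))
    (h : ∀ i, ∑ j, (w j).count i = 1) : DeltaS.mk n ⟶ DeltaS.mk m :=
  DeltaS.Hom.mk w h

/-! ### The symmetric bar construction -/

section Bar

variable (k A : Type*) [CommRing k] [Ring A] [Algebra k A]

theorem prod_map_update_of_notMem {n : ℕ} [DecidableEq (Fin (n + 1))] (v : Fin (n + 1) → A)
    (i : Fin (n + 1)) (x : A) (l : List (Fin (n + 1))) (h : i ∉ l) :
    (l.map (Function.update v i x)).prod = (l.map v).prod := by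
  congr 1
  refine List.map_congr_left fun a ha => ?_
  rw [Function.update_of_ne]
  rintro rfl
  exact h ha

theorem exists_update {X Y : DeltaS} [DecidableEq (Fin (X.n + 1))] (f : DeltaS.Hom X Y)
    (v : Fin (X.n + 1) → A) (i : Fin (X.n + 1)) :
    ∃ (j : Fin (Y.n + 1)) (p q : A), ∀ x,
      (fun l => ((f.word l).map (Function.update v i x)).prod) =
        Function.update (fun l => ((f.word l).map v).prod) j (p * x * q) := by
  obtain rfl : ‹DecidableEq (Fin (X.n + 1))› = instDecidableEqFin _ := Subsingleton.elim _ _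
  have h := f.once i
  obtain ⟨j, hj⟩ : ∃ j, (f.word j).count i ≠ 0 := by
    by_contra! hc
    simp [hc] at h
  have hs := Finset.add_sum_erase Finset.univ (fun j => (f.word j).count i) (Finset.mem_univ j)
  rw [h] at hs
  have hj1 : (f.word j).count i = 1 := by omega
  have h0 : ∑ l ∈ Finset.univ.erase j, (f.word l).count i = 0 := by omega
  obtain ⟨s, t, hst⟩ := List.append_of_mem (List.count_pos_iff.1 (by omega : 0 < (f.word j).count i))
  have hcs : s.count i = 0 ∧ t.count i = 0 := by
    rw [hst] at hj1
    simp only [List.count_append, List.count_cons_self] at hj1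
    omega
  refine ⟨j, (s.map v).prod, (t.map v).prod, fun x => ?_⟩
  funext l
  by_cases hl : l = j
  · subst hl
    rw [Function.update_self, hst, List.map_append, List.map_cons, List.prod_append,
      List.prod_cons, prod_map_update_of_notMem A v i x s (List.count_eq_zero.1 hcs.1),
      prod_map_update_of_notMem A v i x t (List.count_eq_zero.1 hcs.2), Function.update_self,
      mul_assoc]
  · rw [Function.update_of_ne hl, prod_map_update_of_notMem]
    have := (Finset.sum_eq_zero_iff.1 h0) l (Finset.mem_erase.2 ⟨hl, Finset.mem_univ _⟩)
    exact List.count_eq_zero.1 this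

/-- The multilinear map `(a₀, …, a_n) ↦ w₀(a) ⊗ ⋯ ⊗ w_m(a)`, where `w_j(a)` is the value of the
monomial `w_j` at `a` (the empty monomial has the value `1`). -/
def barMultilinear {X Y : DeltaS} (f : DeltaS.Hom X Y) :
    MultilinearMap k (fun _ : Fin (X.n + 1) => A) (⨂[k]^(Y.n + 1) A) where
  toFun v := PiTensorProduct.tprod k fun j => ((f.word j).map v).prod
  map_update_add' v i x y := by
    obtain ⟨j, p, q, h⟩ := exists_update A f v i
    change PiTensorProduct.tprod k (fun l => _) = PiTensorProduct.tprod k (fun l => _) +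
      PiTensorProduct.tprod k (fun l => _)
    rw [h, h, h, mul_add, add_mul, MultilinearMap.map_update_add]
  map_update_smul' v i c x := by
    obtain ⟨j, p, q, h⟩ := exists_update A f v i
    change PiTensorProduct.tprod k (fun l => _) = c • PiTensorProduct.tprod k (fun l => _)
    rw [h, h, mul_smul_comm, smul_mul_assoc, MultilinearMap.map_update_smul]

/-- The linear map `A^{⊗(n+1)} → A^{⊗(m+1)}` induced by a morphism `[n] → [m]` of `ΔS`. -/
def barMap {X Y : DeltaS} (f : X ⟶ Y) : (⨂[k]^(X.n + 1) A) →ₗ[k] (⨂[k]^(Y.n + 1) A) :=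
  PiTensorProduct.lift (barMultilinear k A f)

theorem barMap_tprod {X Y : DeltaS} (f : X ⟶ Y) (v : Fin (X.n + 1) → A) :
    barMap k A f (PiTensorProduct.tprod k v) =
      PiTensorProduct.tprod k fun j => ((DeltaS.Hom.word f j).map v).prod :=
  PiTensorProduct.lift.tprod _

/-- The symmetric bar construction `B^{sym} A : ΔS ⥤ k-Mod`, `[n] ↦ A^{⊗(n+1)}`. -/
def bsym : DeltaS ⥤ ModuleCat k where
  obj X := ModuleCat.of k (⨂[k]^(X.n + 1) A)
  map f := ModuleCat.ofHom (barMap k A f)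
  map_id X := by
    ext1
    refine PiTensorProduct.ext (MultilinearMap.ext fun v => ?_)
    refine (barMap_tprod k A _ v).trans ?_
    change PiTensorProduct.tprod k (fun j => ([j].map v).prod) = PiTensorProduct.tprod k v
    simp
  map_comp f g := by
    ext1
    refine PiTensorProduct.ext (MultilinearMap.ext fun v => ?_)
    refine (barMap_tprod k A _ v).trans ?_
    refine Eq.trans ?_ (congrArg (barMap k A g) (barMap_tprod k A f v)).symm
    rw [barMap_tprod]
    congr 1
    funext j
    change (((DeltaS.Hom.word g j).flatMap (DeltaS.Hom.word f)).map v).prod = _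
    simp only [List.map_flatMap]
    induction DeltaS.Hom.word g j with
    | nil => rfl
    | cons a l ih => rw [List.flatMap_cons, List.prod_append, ih, List.map_cons, List.prod_cons]

end Bar

/-! ### Homology of a category with coefficients in a functor -/

/-- The homology `ker d / im d'` at `M` of linear maps `M' --d'--> M --d--> M''`. -/
abbrev Homology {k M' M M'' : Type*} [CommRing k] [AddCommGroup M'] [AddCommGroup M]
    [AddCommGroup M''] [Module k M'] [Module k M] [Module k M''] (d' : M' →ₗ[k] M)
    (d : M →ₗ[k] M'') : Type _ :=
  LinearMap.ker d ⧸ (LinearMap.range d').submoduleOf (LinearMap.ker d)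

/-- The homology class of a cycle. -/
def homologyClass {k M' M M'' : Type*} [CommRing k] [AddCommGroup M'] [AddCommGroup M]
    [AddCommGroup M''] [Module k M'] [Module k M] [Module k M''] (d' : M' →ₗ[k] M)
    (d : M →ₗ[k] M'') : LinearMap.ker d →ₗ[k] Homology d' d :=
  Submodule.mkQ _

section CatHomology

variable {k : Type*} [CommRing k] {C : Type*} [Category C] (F : C ⥤ ModuleCat k)

/-- The `n`-chains `⨁ F(X₀)`, over all strings `X₀ → X₁ → ⋯ → X_n` of morphisms of `C`. This is
`k[N(- \ C)_n] ⊗_C F`, where `k[N(- \ C)]` is the standard projective resolution of the constant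
functor `k` over `Cᵒᵖ`. -/
abbrev CatChains (n : ℕ) : Type _ :=
  ⨁ c : ComposableArrows C n, F.obj (c.obj 0)

open Classical in
/-- The chain `v ∈ F(X₀)` in the summand of the string `c = (X₀ → ⋯ → X_n)`. -/
def catSingle {n : ℕ} (c : ComposableArrows C n) : F.obj (c.obj 0) →ₗ[k] CatChains F n :=
  DirectSum.lof k (ComposableArrows C n) (fun c => F.obj (c.obj 0)) c

/-- The string obtained from `X₀ → ⋯ → X_{n+1}` by omitting `X_i`. -/
def catFaceString {n : ℕ} (i : Fin (n + 2)) (c : ComposableArrows C (n + 1)) :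
    ComposableArrows C n :=
  c.whiskerLeft (Fin.succAboveOrderEmb i).monotone.functor

open Classical in
/-- The `i`-th face map. It omits `X_i`; the coefficient is transported along the part
`X₀ → X_{δᵢ(0)}` of the string, that is, along `X₀ → X₁` if `i = 0` and along the identity of `X₀`
otherwise. -/
def catFace (n : ℕ) (i : Fin (n + 2)) : CatChains F (n + 1) →ₗ[k] CatChains F n :=
  DirectSum.toModule k (ComposableArrows C (n + 1)) (CatChains F n) fun c =>
    catSingle F (catFaceString i c) ∘ₗ
      (F.map (c.map (homOfLE (Fin.zero_le (i.succAbove 0))))).hom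

theorem catFace_single (n : ℕ) (i : Fin (n + 2)) (c : ComposableArrows C (n + 1))
    (v : F.obj (c.obj 0)) :
    catFace F n i (catSingle F c v) = catSingle F (catFaceString i c)
      (F.map (c.map (homOfLE (Fin.zero_le (i.succAbove 0)))) v) := by
  classical
  simp only [catFace, catSingle]
  rw [DirectSum.toModule_lof]
  rfl

/-- The differential `∑ (-1)^i d_i` from degree `n + 1` to degree `n`. -/
def catD (n : ℕ) : CatChains F (n + 1) →ₗ[k] CatChains F n :=
  ∑ i : Fin (n + 2), (-1 : k) ^ (i : ℕ) • catFace F n i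

/-- The differential that leaves degree `n`; it is zero in degree `0`. -/
def catDFrom : (n : ℕ) → CatChains F n →ₗ[k] CatChains F (n - 1)
  | 0 => 0
  | n + 1 => catD F n

/-- `Tor_n^C(k, F)`, computed by the standard resolution. -/
abbrev CatHomology (n : ℕ) : Type _ := Homology (catD F n) (catDFrom F n)

end CatHomology

section Main

variable (k A : Type*) [CommRing k] [Ring A] [Algebra k A]

/-- Symmetric homology `HS_n(A) = Tor_n^{ΔS}(k, B^{sym} A)`. -/
abbrev HS (n : ℕ) : Type _ := CatHomology (bsym k A) n

/-! ### The partial complex `A ← A^{⊗3} ← A^{⊗4} ⊕ A` -/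

/-- `z₀z₁z₂ : [2] → [0]`. -/
def z012 : DeltaS.mk 2 ⟶ DeltaS.mk 0 := DeltaS.ofWord ![[0, 1, 2]] (by decide)

/-- `z₂z₁z₀ : [2] → [0]`. -/
def z210 : DeltaS.mk 2 ⟶ DeltaS.mk 0 := DeltaS.ofWord ![[2, 1, 0]] (by decide)

/-- The identification of `A^{⊗1}` with `A`. -/
def tensorOne : (⨂[k]^1 A) ≃ₗ[k] A :=
  PiTensorProduct.subsingletonEquiv (R := k) (s := fun _ : Fin 1 => A) 0

theorem tensorOne_tprod (v : Fin 1 → A) : tensorOne k A (PiTensorProduct.tprod k v) = v 0 := by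
  simp [tensorOne]

/-- `a ⊗ b ⊗ c ↦ abc - cba`. -/
def partialD₁ : (⨂[k]^3 A) →ₗ[k] A :=
  (tensorOne k A).toLinearMap ∘ₗ
    (barMap k A z012 - barMap k A z210)

theorem partialD₁_tprod (a b c : A) :
    partialD₁ k A (PiTensorProduct.tprod k ![a, b, c]) = a * b * c - c * b * a := by
  simp only [partialD₁, LinearMap.comp_apply, LinearMap.sub_apply]
  rw [barMap_tprod, barMap_tprod]
  rw [map_sub]
  refine congrArg₂ _ ((tensorOne_tprod k A _).trans ?_) ((tensorOne_tprod k A _).trans ?_)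
  · simp [z012, DeltaS.ofWord, mul_assoc]
  · simp [z210, DeltaS.ofWord, mul_assoc]

/-- The restriction of the second differential to `A^{⊗4}`:
`a ⊗ b ⊗ c ⊗ d ↦ ab ⊗ c ⊗ d + d ⊗ ca ⊗ b + bca ⊗ 1 ⊗ d + d ⊗ bc ⊗ a`. -/
def partialD₂Fst : (⨂[k]^4 A) →ₗ[k] (⨂[k]^3 A) :=
  barMap k A (DeltaS.ofWord (n := 3) (m := 2) ![[0, 1], [2], [3]] (by decide)) +
  barMap k A (DeltaS.ofWord (n := 3) (m := 2) ![[3], [2, 0], [1]] (by decide)) +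
  barMap k A (DeltaS.ofWord (n := 3) (m := 2) ![[1, 2, 0], [], [3]] (by decide)) +
  barMap k A (DeltaS.ofWord (n := 3) (m := 2) ![[3], [1, 2], [0]] (by decide))

/-- The restriction of the second differential to `A`: `a ↦ 1 ⊗ a ⊗ 1`. -/
def partialD₂Snd : A →ₗ[k] (⨂[k]^3 A) :=
  (PiTensorProduct.tprod k).toLinearMap (![1, 1, 1] : Fin 3 → A) 1

/-- The second differential `A^{⊗4} ⊕ A → A^{⊗3}`. -/
def partialD₂ : ((⨂[k]^4 A) × A) →ₗ[k] (⨂[k]^3 A) :=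
  (partialD₂Fst k A).coprod (partialD₂Snd k A)

theorem partialD₂Fst_tprod (a b c d : A) :
    partialD₂Fst k A (PiTensorProduct.tprod k ![a, b, c, d]) =
      PiTensorProduct.tprod k ![a * b, c, d] + PiTensorProduct.tprod k ![d, c * a, b] +
        PiTensorProduct.tprod k ![b * c * a, 1, d] + PiTensorProduct.tprod k ![d, b * c, a] := by
  simp only [partialD₂Fst, LinearMap.add_apply]
  rw [barMap_tprod, barMap_tprod, barMap_tprod, barMap_tprod]
  congr 1
  · congr 1
    · congr 1 <;> congr 1 <;> funext j <;> fin_cases j <;> simp [DeltaS.ofWord]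
    · congr 1; funext j; fin_cases j <;> simp [DeltaS.ofWord, mul_assoc]
  · congr 1; funext j; fin_cases j <;> simp [DeltaS.ofWord]

theorem partialD₂Snd_apply (a : A) :
    partialD₂Snd k A a = PiTensorProduct.tprod k ![1, a, 1] := by
  simp only [partialD₂Snd, MultilinearMap.toLinearMap_apply]
  congr 1
  funext j
  fin_cases j <;> simp

/-- The degree one homology of the partial complex. -/
abbrev PartialH₁ : Type _ := Homology (partialD₂ k A) (partialD₁ k A)

/-! ### The comparison of the partial complex with the standard complex -/

/-- `a ↦ a`, as a chain on the string consisting of the object `[0]` alone. -/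
def compare₀ : A →ₗ[k] CatChains (bsym k A) 0 :=
  catSingle (bsym k A) (ComposableArrows.mk₀ (DeltaS.mk 0)) ∘ₗ
    (tensorOne k A).symm.toLinearMap

/-- `x ⊗ y ⊗ z ↦ (z₀z₁z₂, x ⊗ y ⊗ z) - (z₂z₁z₀, x ⊗ y ⊗ z)`. -/
def compare₁ : (⨂[k]^3 A) →ₗ[k] CatChains (bsym k A) 1 :=
  (show (⨂[k]^3 A) →ₗ[k] CatChains (bsym k A) 1 from
      catSingle (bsym k A) (ComposableArrows.mk₁ z012)) -
    (show (⨂[k]^3 A) →ₗ[k] CatChains (bsym k A) 1 from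
      catSingle (bsym k A) (ComposableArrows.mk₁ z210))

/-! ### The ring `A/([A,A])` and the two actions on chains -/

/-- The two-sided ideal `([A,A])` generated by the commutators. -/
def commutatorIdeal (A : Type*) [Ring A] : TwoSidedIdeal A :=
  TwoSidedIdeal.span {x | ∃ a b : A, x = a * b - b * a}

/-- The quotient ring `A/([A,A])`. -/
abbrev SymQuot (A : Type*) [Ring A] : Type _ := (commutatorIdeal A).ringCon.Quotient

/-- The quotient map `A → A/([A,A])`. -/
def symMk : A →ₐ[k] SymQuot A := (commutatorIdeal A).ringCon.mkₐ k

/-- `x ⊗ y ⊗ z ↦ ax ⊗ y ⊗ z - x ⊗ ya ⊗ z + x ⊗ y ⊗ az`. -/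
def leftAct (a : A) : (⨂[k]^3 A) →ₗ[k] (⨂[k]^3 A) :=
  PiTensorProduct.map ![LinearMap.mulLeft k a, LinearMap.id, LinearMap.id] -
    PiTensorProduct.map ![LinearMap.id, LinearMap.mulRight k a, LinearMap.id] +
    PiTensorProduct.map ![LinearMap.id, LinearMap.id, LinearMap.mulLeft k a]

/-- `x ⊗ y ⊗ z ↦ xa ⊗ y ⊗ z - x ⊗ ay ⊗ z + x ⊗ y ⊗ za`. -/
def rightAct (a : A) : (⨂[k]^3 A) →ₗ[k] (⨂[k]^3 A) :=
  PiTensorProduct.map ![LinearMap.mulRight k a, LinearMap.id, LinearMap.id] -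
    PiTensorProduct.map ![LinearMap.id, LinearMap.mulLeft k a, LinearMap.id] +
    PiTensorProduct.map ![LinearMap.id, LinearMap.id, LinearMap.mulRight k a]

theorem leftAct_tprod (a x y z : A) :
    leftAct k A a (PiTensorProduct.tprod k ![x, y, z]) =
      PiTensorProduct.tprod k ![a * x, y, z] - PiTensorProduct.tprod k ![x, y * a, z] +
        PiTensorProduct.tprod k ![x, y, a * z] := by
  simp only [leftAct, LinearMap.add_apply, LinearMap.sub_apply, PiTensorProduct.map_tprod]
  congr 1
  · congr 1 <;> congr 1 <;> funext j <;> fin_cases j <;> simp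
  · congr 1; funext j; fin_cases j <;> simp

theorem rightAct_tprod (a x y z : A) :
    rightAct k A a (PiTensorProduct.tprod k ![x, y, z]) =
      PiTensorProduct.tprod k ![x * a, y, z] - PiTensorProduct.tprod k ![x, a * y, z] +
        PiTensorProduct.tprod k ![x, y, z * a] := by
  simp only [rightAct, LinearMap.add_apply, LinearMap.sub_apply, PiTensorProduct.map_tprod]
  congr 1
  · congr 1 <;> congr 1 <;> funext j <;> fin_cases j <;> simp
  · congr 1; funext j; fin_cases j <;> simp

end Main

end SymHom

end

/-!
The standard complex computes `Tor` by a projective resolution of the constant functor over the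
opposite of `ΔS`. The partial complex comes from the beginning of another one, made of the functors
`k[ΔS(-, [0])]`, `k[ΔS(-, [2])]` and `k[ΔS(-, [3])] ⊕ k[ΔS(-, [0])]`. Its exactness is a statement
on words in which each of the letters `z₀, …, z_n` occurs once. A generator `X ⊗ Y ⊗ Z` in degree
one is a move from the word `XYZ` to the word `ZYX`. Exactness in degree zero says that these moves
connect all words (`DeltaS.eq_of_comp_z012_eq_comp_z210`). Exactness in degree one says that every
closed path of moves is a consequence of the relations given by `∂₂`. It is used in the dual form
`DeltaS.exists_potential`: a function of the moves that respects the relations is the increment of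
a function of words, a potential.

To find the potential, moves are composed into exchanges of adjacent blocks `VXYU ↦ VYXU`
(`TripleRel.blockSwap`), and `BlockSwap.exists_potential` constructs it by induction on the number
of letters. For each letter `x`, the words that begin with `x` have a potential by induction.
Comparing those for `x` and `y` leaves a defect `f x y V`, which depends on the order of the
remaining letters `V` a priori; the relations force it to be independent of this order
(`defect_eq_of_perm`) and a cocycle in `x` and `y`, so the potentials can be matched by constants.

With a potential whose values are linear maps into the cokernel of `∂₂`, the maps `compare₀` and
`compare₁` get inverses `retract₀` and `retract₁` up to boundaries. They are compatible with the
differentials since all differences of potentials are determined by single moves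
(`comp_potential_sub`). This gives the isomorphisms in degrees zero and one.

The operator `λ_a` puts the letter `a` in front of both ends of a move. Hence the identities for
the action reduce, again by a potential, to a comparison of end points of moves of words in four or
five letters: `λ_a` preserves the image of `∂₂`, `λ_{ab}` and `λ_a λ_b` agree modulo this image,
and `λ_{ab} - λ_{ba}` and `λ_a - ρ_a` factor through `∂₁`, so that they vanish on cycles. The right
action is the left action, turned around by the commutativity of `A/([A,A])`.
-/

noncomputable section

namespace SymHom

/-! ### Potentials on words without repeated letters -/

section Words

variable {α M : Type*} [AddCommGroup M]

/-- Rotations and the transposition of the two leading letters suffice to permute a word; the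
assumptions are needed only for rearrangements of one given word `L`. -/
theorem eq_of_perm_of_rotate_of_swap {N : Type*} {L : List α} {q : List α → N}
    (hrot : ∀ A B, (A ++ B).Perm L → q (A ++ B) = q (B ++ A))
    (hswap : ∀ a b l, (a :: b :: l).Perm L → q (a :: b :: l) = q (b :: a :: l))
    {V W : List α} (hV : V.Perm L) (hVW : V.Perm W) : q V = q W := by
  have key : ∀ {V W : List α}, V.Perm W → ∀ T, (V ++ T).Perm L → q (V ++ T) = q (W ++ T) := by
    intro V W h
    induction h with
    | nil => intro T _; rfl
    | @cons a l₁ l₂ h ih =>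
      intro T hT
      have h1 := hrot [a] (l₁ ++ T) (by simpa using hT)
      have hT' : (l₁ ++ (T ++ [a])).Perm L := by
        refine List.Perm.trans ?_ hT
        rw [← List.append_assoc]
        exact List.perm_append_comm
      have h2 := ih (T ++ [a]) hT'
      have h3 := hrot [a] (l₂ ++ T) (by
        refine List.Perm.trans ?_ hT
        simpa using (h.symm.append_right T))
      simp only [List.append_assoc, List.cons_append, List.nil_append] at *
      rw [h1, h2, h3]
    | swap a b l =>
      intro T hT
      exact hswap b a (l ++ T) (by simpa using hT)
    | trans h₁ h₂ ih₁ ih₂ =>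
      intro T hT
      rw [ih₁ T hT, ih₂ T ((h₁.symm.append_right T).trans hT)]
  simpa using key hVW [] (by simpa using hV)

/-- A family `G V X Y U` that behaves like the increment of a function of words along the exchange
of adjacent blocks `V X Y U ↦ V Y X U`: exchanging back gives the opposite value, the three
exchanges that rotate `X Y Z` into itself add up to zero, and `V X Y U ↦ V Y X U` is the composite
of `V X U Y ↦ V Y X U` with the inverse of `V X U Y ↦ V X Y U`. -/
structure BlockSwap (G : List α → List α → List α → List α → M) : Prop where
  anti : ∀ V X Y U, G V X Y U = -G V Y X U
  cyclic : ∀ V X Y Z U, G V (X ++ Y) Z U + G V (Y ++ Z) X U + G V (Z ++ X) Y U = 0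
  suffix : ∀ V X Y U, G V X Y U = G V (X ++ U) Y [] - G (V ++ X) U Y []

theorem BlockSwap.nil_right {G : List α → List α → List α → List α → M} (hG : BlockSwap G)
    (V X U : List α) : G V X [] U = 0 := by
  have h1 := hG.cyclic V [] [] X U
  have h2 := hG.anti V [] X U
  simp only [List.append_nil, List.nil_append] at h1
  grind

theorem BlockSwap.nil_left {G : List α → List α → List α → List α → M} (hG : BlockSwap G)
    (V X U : List α) : G V [] X U = 0 := by
  rw [hG.anti, hG.nil_right, neg_zero]

/-- If `f x z V` satisfies a three-term relation for all partitions of the remaining letters into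
blocks `A`, `B`, `C`, `U`, then it does not depend on the order of the letters of `V`.

Comparison of the cases `B = C = U = []` and `A = B = C = []` shows that `f x z` is invariant under
rotations. The differences `f x z (y A U) - f x z (y U A)` then change sign under the cyclic
permutation of `x, z, y`, while the sum of the three of them is zero; so they vanish. -/
theorem defect_eq_of_perm {L : List α} {f : α → α → List α → M}
    (hcyc : ∀ x y z A B C U, (x :: z :: (A ++ y :: (B ++ (U ++ C)))).Perm L →
      f x z (A ++ y :: (B ++ (U ++ C))) + f y x (B ++ z :: (C ++ (U ++ A))) +
        f z y (C ++ x :: (A ++ (U ++ B))) = 0)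
    {x z : α} {V W : List α} (hV : (x :: z :: V).Perm L) (hVW : V.Perm W) :
    f x z V = f x z W := by
  have perm2 : ∀ {x z : α} {V W : List α}, (x :: z :: V).Perm L → W.Perm V →
      (x :: z :: W).Perm L := fun h h' => (List.Perm.cons _ (List.Perm.cons _ h')).trans h
  have hrot1 : ∀ {x z : α} A y, (x :: z :: (A ++ [y])).Perm L →
      f x z (A ++ [y]) = f x z (y :: A) := by
    intro x z A y h
    have h1 := hcyc x y z A [] [] [] (by simpa using h)
    have h2 := hcyc x y z [] [] [] A (by
      simpa using perm2 h ((List.perm_append_comm (l₁ := [y]) (l₂ := A))))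
    simp only [List.append_nil, List.nil_append] at h1 h2
    grind
  have hrot : ∀ {x z : α} A B, (x :: z :: (A ++ B)).Perm L → f x z (A ++ B) = f x z (B ++ A) := by
    intro x z A B
    induction B using List.reverseRecOn generalizing A with
    | nil => simp
    | append_singleton B y ih =>
      intro h
      have h1 := hrot1 (A ++ B) y (by simpa using h)
      have h2 := ih (y :: A) (perm2 h (by
        rw [← List.append_assoc]
        exact (List.perm_append_comm (l₁ := [y]) (l₂ := A ++ B))))
      simp only [List.append_assoc, List.cons_append, List.nil_append] at *
      rw [h1, h2]
  have hδ : ∀ x y z A U, (x :: z :: (y :: (A ++ U))).Perm L →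
      f x z (y :: (A ++ U)) - f x z (y :: (U ++ A)) =
        -(f y x (z :: (A ++ U)) - f y x (z :: (U ++ A))) := by
    intro x y z A U h
    have h1 := hcyc x y z A [] [] U (by
      simpa using perm2 h (List.perm_middle))
    have h2 := hcyc x y z [] [] [] (A ++ U) (by simpa using h)
    have h3 := hrot A (y :: U) (x := x) (z := z) (perm2 h List.perm_middle)
    simp only [List.append_nil, List.nil_append, List.cons_append] at h1 h2 h3
    grind
  have hcut : ∀ x y z A U, (x :: z :: (y :: (A ++ U))).Perm L →
      f x z (y :: (A ++ U)) = f x z (y :: (U ++ A)) := by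
    intro x y z A U h
    have p1 : (y :: x :: z :: (A ++ U)).Perm L :=
      (((List.Perm.swap x y _).trans (List.Perm.cons x (List.Perm.swap z y _)))).trans h
    have p2 : (z :: y :: x :: (A ++ U)).Perm L :=
      (((List.Perm.swap y z _).trans (List.Perm.cons y (List.Perm.swap x z _)))).trans p1
    have h1 := hδ x y z A U h
    have h2 := hδ y z x A U p1
    have h3 := hcyc x y z [] [] [] (A ++ U) (by simpa using h)
    have h4 := hcyc x y z [] [] [] (U ++ A) (by
      simpa using perm2 h (List.Perm.cons y List.perm_append_comm))
    simp only [List.append_nil, List.nil_append] at h3 h4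
    grind
  refine eq_of_perm_of_rotate_of_swap (L := V) (fun A B h => hrot A B (perm2 hV h)) ?_
    (List.Perm.refl V) hVW
  intro a b l h
  have h1 := hcut x a z [b] l (perm2 hV (by simpa using h))
  have h2 := hrot (a :: l) [b] (x := x) (z := z) (perm2 hV (by
    refine List.Perm.trans ?_ h
    simp))
  simp only [List.cons_append, List.nil_append] at h1 h2
  rw [h1, h2]

/-- On the words that use each letter of a list `L` exactly once, a `BlockSwap` family is the
increment of a function. The proof is by induction on the length of `L`, for all prefixes `P` at
once: the potentials `h x` of the words that start with `x` exist by induction, and they differ from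
a common potential by constants `g x`. The distinctness of the letters is essential: the
exchange of two equal letters does not change the word, but its value need not be zero. -/
theorem BlockSwap.exists_potential {G : List α → List α → List α → List α → M}
    (hG : BlockSwap G) (L : List α) (hL : L.Nodup) (P : List α) :
    ∃ h : List α → M, ∀ U X Y, (U ++ (X ++ Y)).Perm L →
      G (P ++ U) X Y [] = h (U ++ (X ++ Y)) - h (U ++ (Y ++ X)) := by
  classical
  induction hn : L.length generalizing L P with
  | zero =>
    obtain rfl := List.length_eq_zero_iff.1 hn
    refine ⟨0, fun U X Y h => ?_⟩
    have h' := List.perm_nil.1 h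
    simp only [List.append_eq_nil_iff] at h'
    obtain ⟨rfl, rfl, rfl⟩ := h'
    simp [hG.nil_left]
  | succ n ih =>
    have hex : ∀ x, ∃ h : List α → M, x ∈ L → ∀ U X Y, (x :: (U ++ (X ++ Y))).Perm L →
        G (P ++ x :: U) X Y [] = h (U ++ (X ++ Y)) - h (U ++ (Y ++ X)) := by
      intro x
      by_cases hx : x ∈ L
      · obtain ⟨h, hh⟩ := ih (L.erase x) (hL.erase x) (P ++ [x])
          (by rw [List.length_erase_of_mem hx, hn]; rfl)
        refine ⟨h, fun _ U X Y hp => ?_⟩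
        have := hh U X Y (List.cons_perm_iff_perm_erase.1 hp).2
        simpa using this
      · exact ⟨0, fun h => absurd h hx⟩
    choose h hh' using hex
    have hh : ∀ x U X Y, (x :: (U ++ (X ++ Y))).Perm L →
        G (P ++ x :: U) X Y [] = h x (U ++ (X ++ Y)) - h x (U ++ (Y ++ X)) := fun x U X Y hp =>
      hh' x (hp.subset List.mem_cons_self) U X Y hp
    clear hh'
    -- The defect of the potentials `h x` and `h y` along the exchange of `x :: A` and `y :: B`.
    let f₂ : α → List α → α → List α → M := fun x A y B =>
      G P (x :: A) (y :: B) [] - h x (A ++ y :: B) + h y (B ++ x :: A)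
    have hf₂ : ∀ x A y B U, (x :: (A ++ y :: (B ++ U))).Perm L → G P (x :: A) (y :: B) U =
        h x (A ++ y :: (B ++ U)) - h y (B ++ x :: (A ++ U)) + f₂ x (A ++ U) y B := by
      intro x A y B U hp
      have h1 := hG.suffix P (x :: A) (y :: B) U
      have h2 := hh x A U (y :: B) (by
        refine List.Perm.trans ?_ hp
        refine List.Perm.cons _ (List.Perm.append_left _ ?_)
        exact List.perm_append_comm (l₁ := U) (l₂ := y :: B))
      simp only [f₂, List.append_assoc, List.cons_append] at *
      rw [h1, h2]
      abel
    have hmove : ∀ x A y B U, (x :: (A ++ y :: (B ++ U))).Perm L →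
        f₂ x (A ++ U) y B = f₂ x A y (B ++ U) := by
      intro x A y B U hp
      have p1 : (y :: (B ++ x :: (A ++ U))).Perm L := by
        refine List.Perm.trans ?_ hp
        simpa using List.Perm.append_right U
          (List.perm_append_comm (l₁ := y :: B) (l₂ := x :: A))
      have h1 := hf₂ x A y B U hp
      have h2 := hf₂ y B x A U p1
      have h3 := hG.anti P (x :: A) (y :: B) U
      have h4 := hG.anti P (x :: A) (y :: (B ++ U)) []
      simp only [f₂, List.append_assoc] at *
      grind
    -- By `hmove` the defect depends only on `x`, `y` and the concatenation of the other letters.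
    let f : α → α → List α → M := fun x y V => f₂ x V y []
    have hf : ∀ x A y B U, (x :: (A ++ y :: (B ++ U))).Perm L → G P (x :: A) (y :: B) U =
        h x (A ++ y :: (B ++ U)) - h y (B ++ x :: (A ++ U)) + f x y (A ++ (U ++ B)) := by
      intro x A y B U hp
      have h1 := hmove x (A ++ U) y [] B (by
        refine List.Perm.trans ?_ hp
        simp only [List.append_assoc, List.nil_append]
        refine List.Perm.cons _ (List.Perm.append_left _ ?_)
        exact (List.perm_middle).trans (List.Perm.cons _ List.perm_append_comm))
      rw [hf₂ x A y B U hp]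
      simp only [f, List.append_assoc, List.nil_append] at *
      rw [h1]
    have hanti : ∀ x y V, (x :: y :: V).Perm L → f x y V = -f y x V := by
      intro x y V hp
      have p1 : (x :: (V ++ [y])).Perm L := by
        refine List.Perm.trans (List.Perm.cons x ?_) hp
        exact List.perm_append_comm (l₁ := V) (l₂ := [y])
      have h1 := hf x V y [] [] (by simpa using p1)
      have h2 := hf y [] x V [] (by
        refine List.Perm.trans ?_ p1
        simpa using (List.perm_append_comm (l₁ := [y]) (l₂ := x :: V)))
      have h3 := hG.anti P (x :: V) [y] []
      simp only [List.append_nil, List.nil_append] at *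
      grind
    have hcyc : ∀ x y z A B C U, (x :: z :: (A ++ y :: (B ++ (U ++ C)))).Perm L →
        f x z (A ++ y :: (B ++ (U ++ C))) + f y x (B ++ z :: (C ++ (U ++ A))) +
          f z y (C ++ x :: (A ++ (U ++ B))) = 0 := by
      intro x y z A B C U hp
      have hp' := fun a => (List.perm_iff_count.1 hp a)
      have h1 := hf x (A ++ y :: B) z C U (List.perm_iff_count.2 fun a => by
        rw [← hp' a]; simp only [List.count_append, List.count_cons]; omega)
      have h2 := hf y (B ++ z :: C) x A U (List.perm_iff_count.2 fun a => by
        rw [← hp' a]; simp only [List.count_append, List.count_cons]; omega)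
      have h3 := hf z (C ++ x :: A) y B U (List.perm_iff_count.2 fun a => by
        rw [← hp' a]; simp only [List.count_append, List.count_cons]; omega)
      have h4 := hG.cyclic P (x :: A) (y :: B) (z :: C) U
      simp only [List.append_assoc, List.cons_append] at *
      grind
    have hperm : ∀ {x z : α} {V W : List α}, (x :: z :: V).Perm L → V.Perm W →
        f x z V = f x z W := fun hV hVW => defect_eq_of_perm hcyc hV hVW
    -- By `hperm` the defect is a function `T` of `x` and `y` alone. It is a coboundary, since
    -- `hcyc` makes it a cocycle; the constants `g x` are normalised by `g b = 0`.
    let T : α → α → M := fun x y => f x y ((L.erase x).erase y)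
    have hT : ∀ x y V, (x :: y :: V).Perm L → f x y V = T x y := by
      intro x y V hp
      refine hperm hp ?_
      have h1 := (List.cons_perm_iff_perm_erase.1 hp).2
      exact (List.cons_perm_iff_perm_erase.1 h1).2
    obtain ⟨b, L', rfl⟩ : ∃ b L', L = b :: L' := by
      cases L with
      | nil => simp at hn
      | cons b L' => exact ⟨b, L', rfl⟩
    let g : α → M := fun x => if x = b then 0 else T x b
    have hg : ∀ x y V, (x :: y :: V).Perm (b :: L') → f x y V = g x - g y := by
      intro x y V hp
      have hxy : x ≠ y := by
        have := (hp.nodup_iff).2 hL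
        simp only [List.nodup_cons, List.mem_cons, not_or] at this
        exact this.1.1
      by_cases hx : x = b
      · subst hx
        simp only [g, if_pos, if_neg hxy.symm]
        rw [hanti _ _ _ hp, hT _ _ _ ((List.Perm.swap _ _ _).trans hp), zero_sub]
      · by_cases hy : y = b
        · subst hy
          simp only [g, if_pos, if_neg hxy]
          rw [hT _ _ _ hp, sub_zero]
        · simp only [g, if_neg hx, if_neg hy]
          have hb : b ∈ V := by
            have := hp.symm.subset (List.mem_cons_self (a := b) (l := L'))
            simp only [List.mem_cons] at this
            grind
          have pb := List.perm_cons_erase hb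
          have p1 : (x :: y :: b :: V.erase b).Perm (b :: L') :=
            (List.Perm.cons _ (List.Perm.cons _ pb.symm)).trans hp
          have h1 := hcyc x b y [] [] [] (V.erase b) (by simpa using p1)
          have h2 := hperm hp pb
          have p1' := fun a => (List.perm_iff_count.1 p1 a)
          have p2 : (x :: b :: y :: V.erase b).Perm (b :: L') :=
            List.perm_iff_count.2 fun a => by
              rw [← p1' a]; simp only [List.count_cons]; omega
          have p3 : (y :: b :: x :: V.erase b).Perm (b :: L') :=
            List.perm_iff_count.2 fun a => by
              rw [← p1' a]; simp only [List.count_cons]; omega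
          have h3 := hT _ _ _ p2
          have h4 := hT _ _ _ p3
          have h5 := hanti _ _ _ p2
          simp only [List.append_nil, List.nil_append] at h1
          grind
    refine ⟨fun w => match w with | [] => 0 | x :: v => h x v + g x, fun U X Y hp => ?_⟩
    cases U with
    | cons u U =>
      have := hh u U X Y hp
      simp only [List.cons_append] at *
      rw [this]
      abel
    | nil =>
      cases X with
      | nil => simp [hG.nil_left]
      | cons x A =>
        cases Y with
        | nil => simp [hG.nil_right]
        | cons y B =>
          have h1 := hf x A y B [] (by simpa using hp)
          have h2 := hg x y (A ++ B) (by
            refine List.Perm.trans ?_ hp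
            simpa using List.Perm.cons x (List.perm_middle (a := y) (l₁ := A) (l₂ := B)).symm)
          simp only [List.append_nil, List.nil_append, List.cons_append] at *
          rw [h1, h2]
          abel

/-- The relations that the image of `∂₂` imposes on the generators `X ⊗ Y ⊗ Z` of the degree one
part of the partial complex, for words `X`, `Y`, `Z`. A generator `br X Y Z` stands for the move
`X Y Z ↦ Z Y X`; in particular `br X [] Y` stands for the rotation `X Y ↦ Y X`. -/
structure TripleRel (br : List α → List α → List α → M) : Prop where
  rel : ∀ X Y Z W,
    br (X ++ Y) Z W + br W (Z ++ X) Y + br (Y ++ (Z ++ X)) [] W + br W (Y ++ Z) X = 0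
  one : ∀ X, br [] X [] = 0

namespace TripleRel

variable {br : List α → List α → List α → M}

theorem nil_nil_right (h : TripleRel br) (X : List α) : br X [] [] = 0 := by
  have h1 := h.rel [] [] X []
  have h2 := h.one X
  simp only [List.append_nil, List.nil_append] at h1
  grind

theorem left_nil (h : TripleRel br) (X Y : List α) : br [] X Y = br X [] Y := by
  have h1 := h.rel [] X Y []
  have h2 := h.rel [] [] X Y
  have h3 := h.one (X ++ Y)
  have h4 := h.nil_nil_right (X ++ Y)
  have h5 := h.rel Y [] X []
  have h6 := h.nil_nil_right (X ++ Y)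
  have h7 := h.one (X ++ Y)
  simp only [List.append_nil, List.nil_append] at *
  grind

theorem right_nil (h : TripleRel br) (X Y : List α) : br X Y [] = br X [] Y := by
  have h1 := h.left_nil X Y
  have h2 := h.rel [] [] X Y
  have h3 := h.rel X [] [] Y
  have h4 := h.rel [] [] Y X
  have h5 := h.rel Y [] [] X
  have h6 := h.left_nil Y X
  simp only [List.append_nil, List.nil_append] at *
  grind

theorem rotate_anti (h : TripleRel br) (X Y : List α) : br X [] Y = -br Y [] X := by
  have h1 := h.rel X [] Y []
  have h2 := h.right_nil X Y
  have h3 := h.left_nil Y X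
  have h4 := h.one (Y ++ X)
  have h5 := h.nil_nil_right (Y ++ X)
  simp only [List.append_nil, List.nil_append] at *
  grind

theorem rev (h : TripleRel br) (X Y Z : List α) : br X Y Z = -br Z Y X := by
  have h1 := h.rel [] X Y Z
  have h2 := h.right_nil Z (X ++ Y)
  have h3 := h.rotate_anti (X ++ Y) Z
  simp only [List.append_nil, List.nil_append] at h1
  grind

theorem rotate_cyclic (h : TripleRel br) (X Y Z : List α) :
    br (X ++ Y) [] Z + br (Y ++ Z) [] X + br (Z ++ X) [] Y = 0 := by
  have h1 := h.rel X Y Z []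
  have h2 := h.right_nil (X ++ Y) Z
  have h3 := h.left_nil (Z ++ X) Y
  have h4 := h.left_nil (Y ++ Z) X
  have h5 := h.nil_nil_right (Y ++ (Z ++ X))
  grind

theorem swap (h : TripleRel br) (X Y Z : List α) :
    br X Y Z + br Y X Z = br (X ++ Y) [] Z + br (Y ++ X) [] Z := by
  have h1 := h.rel X Y [] Z
  have h2 := h.rev X Y Z
  have h3 := h.rev Y X Z
  simp only [List.append_nil, List.nil_append] at *
  grind

/-- The exchange of adjacent blocks as a composite of rotations and one move `X Y Z ↦ Z Y X`:
`V X Y U ↦ U V X Y ↦ X Y U V ↦ U V Y X ↦ V Y X U`. -/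
theorem blockSwap (h : TripleRel br) : BlockSwap fun V X Y U =>
    br X Y (U ++ V) - br (X ++ Y) [] (U ++ V) +
      br (V ++ (X ++ Y)) [] U - br (V ++ (Y ++ X)) [] U where
  anti V X Y U := by
    have := h.swap X Y (U ++ V)
    grind
  cyclic V X Y Z U := by
    have h1 := h.rel X Y Z (U ++ V)
    have h2 := h.rev (U ++ V) (Z ++ X) Y
    have h3 := h.rev (U ++ V) (Y ++ Z) X
    have h4 := h.swap (Z ++ X) Y (U ++ V)
    have h5 := h.swap (Y ++ Z) X (U ++ V)
    simp only [List.append_assoc] at *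
    grind
  suffix V Z W U := by
    have h1 := h.rel U V Z W
    have h2 := h.rev W (Z ++ U) V
    have h3 := h.rev W (V ++ Z) U
    have h4 := h.swap Z W (U ++ V)
    have h5 := h.rev W Z (U ++ V)
    have h6 := h.swap (Z ++ U) W V
    have h7 := h.swap U W (V ++ Z)
    have h8 := h.rev W U (V ++ Z)
    have h9 := h.swap U (V ++ Z) W
    -- The relation `h1` yields the claim up to rotations, which cancel by `c1`, `c2` and `c3`.
    have c1 := h.rotate_cyclic (V ++ Z) W U
    have c2 := h.rotate_cyclic (W ++ Z) U V
    have c3 := h.rotate_anti (U ++ V) (W ++ Z)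
    simp only [List.append_assoc, List.nil_append, h.nil_nil_right] at *
    grind

/-- Modulo the relations, the move `X Y Z ↦ Z Y X` is the increment of a function of words without
repeated letters. -/
theorem exists_potential (h : TripleRel br) (L : List α) (hL : L.Nodup) :
    ∃ p : List α → M, ∀ X Y Z, (X ++ (Y ++ Z)).Perm L →
      br X Y Z = p (X ++ (Y ++ Z)) - p (Z ++ (Y ++ X)) := by
  obtain ⟨p, hp⟩ := h.blockSwap.exists_potential L hL []
  refine ⟨p, fun X Y Z hL => ?_⟩
  have p0 := List.perm_append_comm.trans hL
  have h1 := hp Z X Y (by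
    refine List.Perm.trans List.perm_append_comm ?_
    simpa using hL)
  have h2 := hp [] (X ++ Y) Z (by simpa using hL)
  have h3 := h.right_nil (X ++ Y) Z
  have h4 := h.nil_nil_right (Z ++ (X ++ Y))
  have h5 := h.nil_nil_right (Z ++ (Y ++ X))
  have h6 := h.nil_nil_right (X ++ (Y ++ Z))
  simp only [List.append_assoc, List.nil_append] at *
  grind

end TripleRel

end Words

/-! ### Morphisms of `ΔS` into `[0]`, `[2]` and `[3]` as words -/

section Morphisms

namespace DeltaS

variable {X : DeltaS} {M : Type*}

theorem perm_finRange_iff {n : ℕ} (w : List (Fin n)) :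
    w.Perm (List.finRange n) ↔ ∀ i, w.count i = 1 := by
  rw [List.perm_iff_count]
  simp [List.count_eq_one_of_mem (List.nodup_finRange n) (List.mem_finRange _)]

theorem hom_ext {Y : DeltaS} {f g : X ⟶ Y} (h : ∀ j, Hom.word f j = Hom.word g j) : f = g :=
  DeltaS.Hom.ext (funext h)

theorem comp_word {Y Z : DeltaS} (f : X ⟶ Y) (g : Y ⟶ Z) (j : Fin (Z.n + 1)) :
    Hom.word (f ≫ g) j = (Hom.word g j).flatMap (Hom.word f) := rfl

/-- The morphism `[n] ⟶ [0]` given by a word in which every letter occurs exactly once. -/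
def single (w : List (Fin (X.n + 1))) (hw : w.Perm (List.finRange _)) : X ⟶ mk 0 :=
  Hom.mk (fun _ => w) fun i => by simpa using (perm_finRange_iff w).1 hw i

/-- The morphism `U ⊗ V ⊗ W : [n] ⟶ [2]`. -/
def triple (U V W : List (Fin (X.n + 1))) (h : (U ++ (V ++ W)).Perm (List.finRange _)) :
    X ⟶ mk 2 :=
  Hom.mk ![U, V, W] fun i => by
    have := (perm_finRange_iff _).1 h i
    simp only [List.count_append] at this
    refine (Fin.sum_univ_three _).trans ?_
    simpa [add_assoc] using this

/-- The morphism `T ⊗ U ⊗ V ⊗ W : [n] ⟶ [3]`. -/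
def quadruple (T U V W : List (Fin (X.n + 1)))
    (h : (T ++ (U ++ (V ++ W))).Perm (List.finRange _)) : X ⟶ mk 3 :=
  Hom.mk ![T, U, V, W] fun i => by
    have := (perm_finRange_iff _).1 h i
    simp only [List.count_append] at this
    refine (Fin.sum_univ_four _).trans ?_
    simpa [add_assoc] using this

theorem word_perm (f : X ⟶ mk 0) : (Hom.word f 0).Perm (List.finRange _) :=
  (perm_finRange_iff _).2 fun i => by simpa using Hom.once f i

theorem word_append_perm (f : X ⟶ mk 2) :
    (Hom.word f 0 ++ (Hom.word f 1 ++ Hom.word f 2)).Perm (List.finRange _) :=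
  (perm_finRange_iff _).2 fun i => by
    have := (Fin.sum_univ_three _).symm.trans (Hom.once f i)
    simpa [List.count_append, add_assoc] using this

theorem single_word (f : X ⟶ mk 0) : single (Hom.word f 0) (word_perm f) = f :=
  hom_ext fun j => by obtain rfl := Subsingleton.elim (α := Fin 1) 0 j; rfl

theorem triple_word (f : X ⟶ mk 2) :
    triple (Hom.word f 0) (Hom.word f 1) (Hom.word f 2) (word_append_perm f) = f :=
  hom_ext fun j => by
    change Fin 3 at j
    fin_cases j <;> rfl

theorem comp_z012_word (f : X ⟶ mk 2) :
    Hom.word (f ≫ z012) 0 = Hom.word f 0 ++ (Hom.word f 1 ++ Hom.word f 2) := by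
  simp [comp_word, z012, ofWord]

theorem comp_z210_word (f : X ⟶ mk 2) :
    Hom.word (f ≫ z210) 0 = Hom.word f 2 ++ (Hom.word f 1 ++ Hom.word f 0) := by
  simp [comp_word, z210, ofWord]

theorem single_congr {w w' : List (Fin (X.n + 1))} (h : w = w') (hw hw') :
    single w hw = single w' hw' := by subst h; rfl

theorem triple_comp_z012 (U V W : List (Fin (X.n + 1))) (h h') :
    triple U V W h ≫ z012 = single (U ++ (V ++ W)) h' :=
  (single_word _).symm.trans (single_congr (comp_z012_word _) _ _)

theorem triple_comp_z210 (U V W : List (Fin (X.n + 1))) (h h') :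
    triple U V W h ≫ z210 = single (W ++ (V ++ U)) h' :=
  (single_word _).symm.trans (single_congr (comp_z210_word _) _ _)

/-- The moves `X Y Z ↦ Z Y X` connect any two morphisms `[n] ⟶ [0]`. This is the exactness of the
partial complex of representable functors in degree zero. -/
theorem eq_of_comp_z012_eq_comp_z210 {q : (X ⟶ mk 0) → M}
    (hq : ∀ f : X ⟶ mk 2, q (f ≫ z012) = q (f ≫ z210)) (f g : X ⟶ mk 0) : q f = q g := by
  classical
  let q' : List (Fin (X.n + 1)) → M := fun w =>
    if h : w.Perm (List.finRange _) then q (single w h) else q f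
  have hq' : ∀ U V W, (U ++ (V ++ W)).Perm (List.finRange _) →
      q' (U ++ (V ++ W)) = q' (W ++ (V ++ U)) := by
    intro U V W h
    have h' : (W ++ (V ++ U)).Perm (List.finRange _) := by
      refine List.Perm.trans ?_ h
      refine List.perm_append_comm.trans ?_
      simpa using (List.perm_append_comm (l₁ := V) (l₂ := U)).append_right W
    simp only [q', dif_pos h, dif_pos h']
    rw [← triple_comp_z012 U V W h, ← triple_comp_z210 U V W h, hq]
  have hw : ∀ f : X ⟶ mk 0, q' (Hom.word f 0) = q f := fun f => by
    simp only [q', dif_pos (word_perm f), single_word]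
  have hrot : ∀ A B, (A ++ B).Perm (List.finRange _) → q' (A ++ B) = q' (B ++ A) :=
    fun A B h => hq' A [] B h
  rw [← hw f, ← hw g]
  refine eq_of_perm_of_rotate_of_swap hrot ?_ (word_perm f)
    ((word_perm f).trans (word_perm g).symm)
  intro a b l h
  have h1 := hq' [a] [b] l h
  refine h1.trans (hrot l [b, a] ?_)
  refine List.Perm.trans ?_ h
  exact List.perm_append_comm.trans (List.Perm.swap a b l)

/-- A function of the morphisms `[n] ⟶ [2]` that respects the relations coming from `∂₂` is the
increment, along the moves `X Y Z ↦ Z Y X`, of a function of the morphisms `[n] ⟶ [0]`. This is the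
exactness of the partial complex of representable functors in degree one. -/
theorem exists_potential [AddCommGroup M] {T : (X ⟶ mk 2) → M}
    (hrel : ∀ f : X ⟶ mk 3,
      T (f ≫ ofWord ![[0, 1], [2], [3]] (by decide)) +
        T (f ≫ ofWord ![[3], [2, 0], [1]] (by decide)) +
        T (f ≫ ofWord ![[1, 2, 0], [], [3]] (by decide)) +
        T (f ≫ ofWord ![[3], [1, 2], [0]] (by decide)) = 0)
    (hone : ∀ f : X ⟶ mk 0, T (f ≫ ofWord ![[], [0], []] (by decide)) = 0) :
    ∃ p : (X ⟶ mk 0) → M, ∀ f : X ⟶ mk 2, T f = p (f ≫ z012) - p (f ≫ z210) := by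
  classical
  -- Triples of words that do not use every letter once are given the value zero; the relations
  -- hold for them because all terms of a relation use the same letters.
  let br : List (Fin (X.n + 1)) → List (Fin (X.n + 1)) → List (Fin (X.n + 1)) → M := fun U V W =>
    if h : (U ++ (V ++ W)).Perm (List.finRange _) then T (triple U V W h) else 0
  have hbr : ∀ f : X ⟶ mk 2, br (Hom.word f 0) (Hom.word f 1) (Hom.word f 2) = T f := fun f => by
    simp only [br, dif_pos (word_append_perm f), triple_word]
  have h : TripleRel br := by
    constructor
    · intro U V W Z
      by_cases hp : (U ++ (V ++ (W ++ Z))).Perm (List.finRange _)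
      · have := hrel (quadruple U V W Z hp)
        rw [← hbr, ← hbr, ← hbr, ← hbr] at this
        simpa [comp_word, ofWord, quadruple] using this
      · have hp' : ∀ U' V' W', (U' ++ (V' ++ W')).Perm (U ++ (V ++ (W ++ Z))) →
            br U' V' W' = 0 := fun U' V' W' h => dif_neg fun h' => hp (h.symm.trans h')
        rw [hp', hp', hp', hp']
        · simp
        all_goals
          refine List.perm_iff_count.2 fun a => ?_
          simp only [List.count_append, List.count_nil]
          omega
    · intro U
      by_cases hp : U.Perm (List.finRange _)
      · have := hone (single U hp)
        rw [← hbr] at this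
        simpa [comp_word, ofWord, single] using this
      · exact dif_neg (by simpa using hp)
  obtain ⟨p, hp⟩ := h.exists_potential (List.finRange _) (List.nodup_finRange _)
  refine ⟨fun f => p (Hom.word f 0), fun f => ?_⟩
  rw [← hbr, hp _ _ _ (word_append_perm f)]
  dsimp only
  rw [comp_z012_word, comp_z210_word]

end DeltaS

end Morphisms

/-! ### The standard complex in low degrees -/

section CatChains

variable {k : Type*} [CommRing k] {C : Type*} [Category C] (F : C ⥤ ModuleCat k)

/-- The chain `v ∈ F(X)` on the object `X`. -/
def single₀ (X : C) : F.obj X →ₗ[k] CatChains F 0 := catSingle F (ComposableArrows.mk₀ X)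

/-- The chain `v ∈ F(X)` on the string `X ⟶ Y`. -/
def single₁ {X Y : C} (f : X ⟶ Y) : F.obj X →ₗ[k] CatChains F 1 :=
  catSingle F (ComposableArrows.mk₁ f)

/-- The chain `v ∈ F(X)` on the string `X ⟶ Y ⟶ Z`. -/
def single₂ {X Y Z : C} (f : X ⟶ Y) (g : Y ⟶ Z) : F.obj X →ₗ[k] CatChains F 2 :=
  catSingle F (ComposableArrows.mk₂ f g)

theorem catSingle_zero (c : ComposableArrows C 0) (v : F.obj (c.obj 0)) :
    catSingle F c v = single₀ F (c.obj 0) v := by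
  obtain ⟨X, rfl⟩ := c.mk₀_surjective
  rfl

theorem catSingle_one (c : ComposableArrows C 1) (v : F.obj (c.obj 0)) :
    catSingle F c v = single₁ F (c.map (homOfLE (Fin.zero_le 1))) v := by
  obtain ⟨X, Y, f, rfl⟩ := c.mk₁_surjective
  rfl

theorem catSingle_two (c : ComposableArrows C 2) (v : F.obj (c.obj 0)) :
    ∃ (X Y Z : C) (f : X ⟶ Y) (g : Y ⟶ Z) (w : F.obj X), catSingle F c v = single₂ F f g w := by
  obtain ⟨X, Y, Z, f, g, rfl⟩ := c.mk₂_surjective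
  exact ⟨X, Y, Z, f, g, v, rfl⟩

theorem catD_apply {n : ℕ} (x : CatChains F (n + 1)) :
    catD F n x = ∑ i : Fin (n + 2), (-1 : k) ^ (i : ℕ) • catFace F n i x := by
  simp only [catD, LinearMap.sum_apply, LinearMap.smul_apply]

theorem catD_single₁ {X Y : C} (f : X ⟶ Y) (v : F.obj X) :
    catD F 0 (single₁ F f v) = single₀ F Y (F.map f v) - single₀ F X v := by
  have h0 : catFace F 0 0 (single₁ F f v) = single₀ F Y (F.map f v) :=
    (catFace_single F 0 0 _ _).trans (catSingle_zero F _ _)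
  have h1 : catFace F 0 1 (single₁ F f v) = single₀ F X v := by
    refine ((catFace_single F 0 1 _ _).trans (catSingle_zero F _ _)).trans ?_
    change single₀ F X (F.map (𝟙 X) v) = _
    simp
  refine (catD_apply F _).trans ((Fin.sum_univ_two _).trans ?_)
  refine (congrArg₂ _ (congrArg _ h0) (congrArg _ h1)).trans ?_
  simp [sub_eq_add_neg]

theorem catD_single₂ {X Y Z : C} (f : X ⟶ Y) (g : Y ⟶ Z) (v : F.obj X) :
    catD F 1 (single₂ F f g v) =
      single₁ F g (F.map f v) - single₁ F (f ≫ g) v + single₁ F f v := by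
  have h0 : catFace F 1 0 (single₂ F f g v) = single₁ F g (F.map f v) :=
    (catFace_single F 1 0 _ _).trans (catSingle_one F _ _)
  have h1 : catFace F 1 1 (single₂ F f g v) = single₁ F (f ≫ g) v := by
    refine ((catFace_single F 1 1 _ _).trans (catSingle_one F _ _)).trans ?_
    change single₁ F (f ≫ g) (F.map (𝟙 X) v) = _
    simp
  have h2 : catFace F 1 2 (single₂ F f g v) = single₁ F f v := by
    refine ((catFace_single F 1 2 _ _).trans (catSingle_one F _ _)).trans ?_
    change single₁ F f (F.map (𝟙 X) v) = _
    simp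
  refine (catD_apply F _).trans ((Fin.sum_univ_three _).trans ?_)
  refine (congrArg₂ _ (congrArg₂ _ (congrArg _ h0) (congrArg _ h1)) (congrArg _ h2)).trans ?_
  simp [sub_eq_add_neg]

variable {F} {M : Type*} [AddCommGroup M] [Module k M]

theorem catChains_hom_ext {n : ℕ} {φ ψ : CatChains F n →ₗ[k] M}
    (h : ∀ (c : ComposableArrows C n) (v : F.obj (c.obj 0)),
      φ (catSingle F c v) = ψ (catSingle F c v)) : φ = ψ := by
  classical
  refine DirectSum.linearMap_ext _ fun c => LinearMap.ext fun v => ?_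
  exact h c v

theorem catChains_hom_ext₀ {φ ψ : CatChains F 0 →ₗ[k] M}
    (h : ∀ X (v : F.obj X), φ (single₀ F X v) = ψ (single₀ F X v)) : φ = ψ :=
  catChains_hom_ext fun c v => by rw [catSingle_zero]; exact h _ _

theorem catChains_hom_ext₁ {φ ψ : CatChains F 1 →ₗ[k] M}
    (h : ∀ X Y (f : X ⟶ Y) (v : F.obj X), φ (single₁ F f v) = ψ (single₁ F f v)) : φ = ψ :=
  catChains_hom_ext fun c v => by rw [catSingle_one]; exact h _ _ _ _

theorem catChains_hom_ext₂ {φ ψ : CatChains F 2 →ₗ[k] M}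
    (h : ∀ X Y Z (f : X ⟶ Y) (g : Y ⟶ Z) (v : F.obj X),
      φ (single₂ F f g v) = ψ (single₂ F f g v)) : φ = ψ :=
  catChains_hom_ext fun c v => by
    obtain ⟨X, Y, Z, f, g, w, hw⟩ := catSingle_two F c v
    rw [hw]; exact h _ _ _ _ _ _

open Classical in
/-- The linear map on the `n`-chains with the given restrictions to the summands. -/
def descend {n : ℕ} (φ : ∀ c : ComposableArrows C n, F.obj (c.obj 0) →ₗ[k] M) :
    CatChains F n →ₗ[k] M :=
  DirectSum.toModule k (ComposableArrows C n) M φ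

theorem descend_catSingle {n : ℕ} (φ : ∀ c : ComposableArrows C n, F.obj (c.obj 0) →ₗ[k] M)
    (c : ComposableArrows C n) (v : F.obj (c.obj 0)) : descend φ (catSingle F c v) = φ c v := by
  classical
  simp only [descend, catSingle]
  rw [DirectSum.toModule_lof]

/-- The linear map on the `0`-chains with the given restrictions to the summands. -/
def descend₀ (φ : ∀ X, F.obj X →ₗ[k] M) : CatChains F 0 →ₗ[k] M :=
  descend fun c => φ (c.obj 0)

theorem descend₀_single₀ (φ : ∀ X, F.obj X →ₗ[k] M) (X : C) (v : F.obj X) :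
    descend₀ φ (single₀ F X v) = φ X v :=
  descend_catSingle (fun c => φ (c.obj 0)) (ComposableArrows.mk₀ X) v

/-- The linear map on the `1`-chains with the given restrictions to the summands. -/
def descend₁ (φ : ∀ X Y, (X ⟶ Y) → (F.obj X →ₗ[k] M)) : CatChains F 1 →ₗ[k] M :=
  descend fun c => φ _ _ (c.map (homOfLE (Fin.zero_le 1)))

theorem descend₁_single₁ (φ : ∀ X Y, (X ⟶ Y) → (F.obj X →ₗ[k] M)) {X Y : C} (f : X ⟶ Y)
    (v : F.obj X) : descend₁ φ (single₁ F f v) = φ X Y f v :=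
  descend_catSingle (fun c => φ _ _ (c.map (homOfLE (Fin.zero_le 1)))) (ComposableArrows.mk₁ f) v

end CatChains

/-! ### Comparison of the partial complex with the standard complex -/

section Comparison

variable (k A : Type*) [CommRing k] [Ring A] [Algebra k A]

theorem barMap_comp {X Y Z : DeltaS} (f : X ⟶ Y) (g : Y ⟶ Z) (v : ⨂[k]^(X.n + 1) A) :
    barMap k A (f ≫ g) v = barMap k A g (barMap k A f v) :=
  congrArg (fun φ => φ.hom v) ((bsym k A).map_comp f g)

theorem barMap_id {X : DeltaS} (v : ⨂[k]^(X.n + 1) A) : barMap k A (𝟙 X) v = v :=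
  congrArg (fun φ => φ.hom v) ((bsym k A).map_id X)

theorem tensorPower_hom_ext {n : ℕ} {M : Type*} [AddCommGroup M] [Module k M]
    {φ ψ : (⨂[k]^n A) →ₗ[k] M}
    (h : ∀ v : Fin n → A, φ (PiTensorProduct.tprod k v) = ψ (PiTensorProduct.tprod k v)) :
    φ = ψ :=
  PiTensorProduct.ext (MultilinearMap.ext h)

theorem tensorCube_hom_ext {M : Type*} [AddCommGroup M] [Module k M]
    {φ ψ : (⨂[k]^3 A) →ₗ[k] M}
    (h : ∀ x y z : A, φ (PiTensorProduct.tprod k ![x, y, z]) =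
      ψ (PiTensorProduct.tprod k ![x, y, z])) : φ = ψ :=
  tensorPower_hom_ext k A fun v => by
    have hv : v = ![v 0, v 1, v 2] := by funext i; fin_cases i <;> rfl
    rw [hv]; exact h _ _ _

theorem partialD₂Snd_eq_barMap (t : ⨂[k]^1 A) :
    partialD₂Snd k A (tensorOne k A t) =
      barMap k A (DeltaS.ofWord (n := 0) (m := 2) ![[], [0], []] (by decide)) t := by
  revert t
  refine LinearMap.congr_fun (f := partialD₂Snd k A ∘ₗ (tensorOne k A).toLinearMap) ?_
  refine tensorPower_hom_ext k A fun v => ?_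
  refine Eq.trans ?_ (barMap_tprod k A _ v).symm
  refine (congrArg (partialD₂Snd k A) (tensorOne_tprod k A v)).trans ?_
  rw [partialD₂Snd_apply]
  congr 1
  funext j
  fin_cases j <;> simp [DeltaS.ofWord]

theorem partialD₂Snd_eq_barMap' (a : A) :
    partialD₂Snd k A a = barMap k A (DeltaS.ofWord (n := 0) (m := 2) ![[], [0], []] (by decide))
      ((tensorOne k A).symm a) := by
  rw [← partialD₂Snd_eq_barMap, LinearEquiv.apply_symm_apply]

/-- The cokernel of `∂₂`. -/
abbrev CokerD₂ : Type _ := (⨂[k]^3 A) ⧸ LinearMap.range (partialD₂ k A)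

theorem mk_partialD₂Fst (t : ⨂[k]^4 A) :
    (LinearMap.range (partialD₂ k A)).mkQ (partialD₂Fst k A t) = 0 := by
  rw [Submodule.mkQ_apply, Submodule.Quotient.mk_eq_zero]
  exact ⟨(t, 0), by simp [partialD₂]⟩

theorem mk_partialD₂Snd (a : A) :
    (LinearMap.range (partialD₂ k A)).mkQ (partialD₂Snd k A a) = 0 := by
  rw [Submodule.mkQ_apply, Submodule.Quotient.mk_eq_zero]
  exact ⟨(0, a), by simp [partialD₂]⟩

theorem range_partialD₂_le {S : Submodule k (⨂[k]^3 A)}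
    (h₁ : ∀ t, partialD₂Fst k A t ∈ S) (h₂ : ∀ a, partialD₂Snd k A a ∈ S) :
    LinearMap.range (partialD₂ k A) ≤ S := by
  rintro _ ⟨⟨t, a⟩, rfl⟩
  simpa [partialD₂] using S.add_mem (h₁ t) (h₂ a)

/-- The telescoping sum behind `∂₁ ∘ ∂₂ = 0`: the four terms of `∂₂` are consecutive moves
`XYZW ↦ WZXY ↦ YZXW ↦ WYZX ↦ XYZW`. -/
theorem sum_words_eq_zero {M : Type*} [AddCommGroup M] (q : (DeltaS.mk 3 ⟶ DeltaS.mk 0) → M)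
    {T : (DeltaS.mk 3 ⟶ DeltaS.mk 2) → M} (hT : ∀ f, T f = q (f ≫ z012) - q (f ≫ z210)) :
    T (DeltaS.ofWord ![[0, 1], [2], [3]] (by decide)) +
      T (DeltaS.ofWord ![[3], [2, 0], [1]] (by decide)) +
      T (DeltaS.ofWord ![[1, 2, 0], [], [3]] (by decide)) +
      T (DeltaS.ofWord ![[3], [1, 2], [0]] (by decide)) = 0 := by
  have e : ∀ {f g : DeltaS.mk 3 ⟶ DeltaS.mk 0}, DeltaS.Hom.word f 0 = DeltaS.Hom.word g 0 →
      q f = q g := fun {f g} h => by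
    rw [← DeltaS.single_word f, ← DeltaS.single_word g, DeltaS.single_congr h]
  rw [hT, hT, hT, hT]
  rw [e (f := DeltaS.ofWord ![[0, 1], [2], [3]] (by decide) ≫ z210)
      (g := DeltaS.ofWord ![[3], [2, 0], [1]] (by decide) ≫ z012) (by decide),
    e (f := DeltaS.ofWord ![[3], [2, 0], [1]] (by decide) ≫ z210)
      (g := DeltaS.ofWord ![[1, 2, 0], [], [3]] (by decide) ≫ z012) (by decide),
    e (f := DeltaS.ofWord ![[1, 2, 0], [], [3]] (by decide) ≫ z210)
      (g := DeltaS.ofWord ![[3], [1, 2], [0]] (by decide) ≫ z012) (by decide),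
    e (f := DeltaS.ofWord ![[3], [1, 2], [0]] (by decide) ≫ z210)
      (g := DeltaS.ofWord ![[0, 1], [2], [3]] (by decide) ≫ z012) (by decide)]
  abel

/-- A linear map on `A^{⊗3}` kills the image of `∂₂` if on each `F(f)(v)`, `f : [n] ⟶ [2]`, it is
the increment along the move from `f ≫ z012` to `f ≫ z210`. -/
theorem range_partialD₂_le_ker_of_increment {M : Type*} [AddCommGroup M] [Module k M]
    (φ : (⨂[k]^3 A) →ₗ[k] M)
    (hφ : ∀ X, ∃ q : (X ⟶ DeltaS.mk 0) → (⨂[k]^(X.n + 1) A) →ₗ[k] M,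
      ∀ f : X ⟶ DeltaS.mk 2, φ ∘ₗ barMap k A f = q (f ≫ z012) - q (f ≫ z210)) :
    LinearMap.range (partialD₂ k A) ≤ LinearMap.ker φ := by
  refine range_partialD₂_le k A (fun t => ?_) (fun a => ?_)
  · obtain ⟨q, hq⟩ := hφ (DeltaS.mk 3)
    have := LinearMap.congr_fun (sum_words_eq_zero q hq) t
    rw [LinearMap.mem_ker]
    simpa [partialD₂Fst] using this
  · obtain ⟨q, hq⟩ := hφ (DeltaS.mk 0)
    rw [LinearMap.mem_ker, partialD₂Snd_eq_barMap']
    refine (LinearMap.congr_fun (hq _) _).trans ?_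
    rw [show DeltaS.ofWord (n := 0) (m := 2) ![[], [0], []] (by decide) ≫ z012 =
      DeltaS.ofWord (n := 0) (m := 2) ![[], [0], []] (by decide) ≫ z210 from
        DeltaS.hom_ext (by decide), sub_self, LinearMap.zero_apply]

/-- The potential is taken with values in linear maps, so that it is linear in the tensor. -/
theorem exists_hom_potential (X : DeltaS) :
    ∃ p : (X ⟶ DeltaS.mk 0) → (⨂[k]^(X.n + 1) A) →ₗ[k] CokerD₂ k A, ∀ f : X ⟶ DeltaS.mk 2,
      (LinearMap.range (partialD₂ k A)).mkQ ∘ₗ barMap k A f = p (f ≫ z012) - p (f ≫ z210) := by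
  refine DeltaS.exists_potential (fun f => ?_) fun f => ?_
  · refine LinearMap.ext fun t => ?_
    have := mk_partialD₂Fst k A (barMap k A f t)
    simp only [LinearMap.add_apply, LinearMap.comp_apply, partialD₂Fst, map_add,
      LinearMap.zero_apply, barMap_comp] at this ⊢
    exact this
  · refine LinearMap.ext fun t => ?_
    simp only [LinearMap.comp_apply, barMap_comp]
    rw [← partialD₂Snd_eq_barMap, mk_partialD₂Snd, LinearMap.zero_apply]

/-- A potential for the class of `F(f)(v)` modulo the image of `∂₂`, where `f : [n] ⟶ [2]`; it is a
function of the morphisms `[n] ⟶ [0]` and linear in `v`, determined up to a constant. -/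
def potential (X : DeltaS) (f : X ⟶ DeltaS.mk 0) : (⨂[k]^(X.n + 1) A) →ₗ[k] CokerD₂ k A :=
  (exists_hom_potential k A X).choose f

theorem potential_spec {X : DeltaS} (f : X ⟶ DeltaS.mk 2) :
    (LinearMap.range (partialD₂ k A)).mkQ ∘ₗ barMap k A f =
      potential k A X (f ≫ z012) - potential k A X (f ≫ z210) :=
  (exists_hom_potential k A X).choose_spec f

/-- The differences of the potential are determined by their values along single moves, because the
moves connect all morphisms `[n] ⟶ [0]`. -/
theorem comp_potential_sub {X : DeltaS} {M : Type*} [AddCommGroup M] [Module k M]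
    (φ : CokerD₂ k A →ₗ[k] M) (q : (X ⟶ DeltaS.mk 0) → (⨂[k]^(X.n + 1) A) →ₗ[k] M)
    (h : ∀ f : X ⟶ DeltaS.mk 2, φ ∘ₗ (LinearMap.range (partialD₂ k A)).mkQ ∘ₗ barMap k A f =
      q (f ≫ z012) - q (f ≫ z210)) (f g : X ⟶ DeltaS.mk 0) (v : ⨂[k]^(X.n + 1) A) :
    φ (potential k A X f v - potential k A X g v) = q f v - q g v := by
  have := DeltaS.eq_of_comp_z012_eq_comp_z210 (q := fun f => φ ∘ₗ potential k A X f - q f)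
    (fun f => by
      have h1 := h f
      rw [potential_spec, LinearMap.comp_sub] at h1
      rw [sub_eq_sub_iff_sub_eq_sub, h1]) f g
  have := LinearMap.congr_fun this v
  simp only [LinearMap.sub_apply, LinearMap.comp_apply] at this
  rw [map_sub, ← sub_eq_sub_iff_sub_eq_sub, this]

/-- The potentials are natural in `[n]` up to constants. -/
theorem potential_naturality {X Y : DeltaS} (f : X ⟶ Y) (g g' : Y ⟶ DeltaS.mk 0)
    (v : ⨂[k]^(X.n + 1) A) :
    potential k A Y g (barMap k A f v) - potential k A Y g' (barMap k A f v) =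
      potential k A X (f ≫ g) v - potential k A X (f ≫ g') v := by
  have := DeltaS.eq_of_comp_z012_eq_comp_z210
    (q := fun g => potential k A Y g ∘ₗ barMap k A f - potential k A X (f ≫ g)) (fun g => by
      rw [sub_eq_sub_iff_sub_eq_sub, ← LinearMap.sub_comp, ← potential_spec]
      simp only [← Category.assoc]
      rw [← potential_spec]
      refine LinearMap.ext fun t => ?_
      simp [barMap_comp]) g g'
  have := LinearMap.congr_fun this v
  simp only [LinearMap.sub_apply, LinearMap.comp_apply] at this
  rw [← sub_eq_sub_iff_sub_eq_sub, this]

/-- `single₀` for the symmetric bar construction, with the tensor power as its source. -/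
def barSingle₀ (X : DeltaS) : (⨂[k]^(X.n + 1) A) →ₗ[k] CatChains (bsym k A) 0 :=
  single₀ (bsym k A) X

/-- `single₁` for the symmetric bar construction, with the tensor power as its source. -/
def barSingle₁ {X Y : DeltaS} (f : X ⟶ Y) :
    (⨂[k]^(X.n + 1) A) →ₗ[k] CatChains (bsym k A) 1 :=
  single₁ (bsym k A) f

/-- `single₂` for the symmetric bar construction, with the tensor power as its source. -/
def barSingle₂ {X Y Z : DeltaS} (f : X ⟶ Y) (g : Y ⟶ Z) :
    (⨂[k]^(X.n + 1) A) →ₗ[k] CatChains (bsym k A) 2 :=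
  single₂ (bsym k A) f g

theorem catD_barSingle₁ {X Y : DeltaS} (f : X ⟶ Y) (v : ⨂[k]^(X.n + 1) A) :
    catD (bsym k A) 0 (barSingle₁ k A f v) =
      barSingle₀ k A Y (barMap k A f v) - barSingle₀ k A X v :=
  catD_single₁ (bsym k A) f v

theorem catD_barSingle₂ {X Y Z : DeltaS} (f : X ⟶ Y) (g : Y ⟶ Z) (v : ⨂[k]^(X.n + 1) A) :
    catD (bsym k A) 1 (barSingle₂ k A f g v) =
      barSingle₁ k A g (barMap k A f v) - barSingle₁ k A (f ≫ g) v + barSingle₁ k A f v :=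
  catD_single₂ (bsym k A) f g v

theorem barChains_hom_ext₀ {M : Type*} [AddCommGroup M] [Module k M]
    {φ ψ : CatChains (bsym k A) 0 →ₗ[k] M}
    (h : ∀ (X : DeltaS) (v : ⨂[k]^(X.n + 1) A),
      φ (barSingle₀ k A X v) = ψ (barSingle₀ k A X v)) : φ = ψ :=
  catChains_hom_ext₀ h

theorem barChains_hom_ext₁ {M : Type*} [AddCommGroup M] [Module k M]
    {φ ψ : CatChains (bsym k A) 1 →ₗ[k] M}
    (h : ∀ (X Y : DeltaS) (f : X ⟶ Y) (v : ⨂[k]^(X.n + 1) A),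
      φ (barSingle₁ k A f v) = ψ (barSingle₁ k A f v)) : φ = ψ :=
  catChains_hom_ext₁ h

theorem barChains_hom_ext₂ {M : Type*} [AddCommGroup M] [Module k M]
    {φ ψ : CatChains (bsym k A) 2 →ₗ[k] M}
    (h : ∀ (X Y Z : DeltaS) (f : X ⟶ Y) (g : Y ⟶ Z) (v : ⨂[k]^(X.n + 1) A),
      φ (barSingle₂ k A f g v) = ψ (barSingle₂ k A f g v)) : φ = ψ :=
  catChains_hom_ext₂ h

/-- The morphism `z₀z₁⋯z_n : [n] ⟶ [0]`, chosen as a base point among the morphisms `[n] ⟶ [0]`. -/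
def toZero (X : DeltaS) : X ⟶ DeltaS.mk 0 := DeltaS.single (List.finRange _) (List.Perm.refl _)

theorem toZero_zero : toZero (DeltaS.mk 0) = 𝟙 _ := DeltaS.hom_ext (by decide)

/-- The left inverse `(X, v) ↦ F(z₀⋯z_n)(v)` of `compare₀`. -/
def retract₀ : CatChains (bsym k A) 0 →ₗ[k] A :=
  descend₀ fun X => (tensorOne k A).toLinearMap ∘ₗ barMap k A (toZero X)

/-- The left inverse of `compare₁` modulo the image of `∂₂`: the chain `v` on `f : X ⟶ Y` is sent to
the difference of the potentials of the two morphisms `X ⟶ Y ⟶ [0]` and `X ⟶ [0]`. -/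
def retract₁ : CatChains (bsym k A) 1 →ₗ[k] CokerD₂ k A :=
  descend₁ fun X Y f => potential k A X (f ≫ toZero Y) - potential k A X (toZero X)

theorem retract₀_single (X : DeltaS) (v : ⨂[k]^(X.n + 1) A) :
    retract₀ k A (barSingle₀ k A X v) = tensorOne k A (barMap k A (toZero X) v) :=
  descend₀_single₀ _ _ _

theorem retract₁_single {X Y : DeltaS} (f : X ⟶ Y) (v : ⨂[k]^(X.n + 1) A) :
    retract₁ k A (barSingle₁ k A f v) =
      potential k A X (f ≫ toZero Y) v - potential k A X (toZero X) v :=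
  descend₁_single₁ _ _ _

theorem compare₀_apply (a : A) :
    compare₀ k A a = barSingle₀ k A (DeltaS.mk 0) ((tensorOne k A).symm a) := rfl

theorem retract₀_compare₀ (a : A) : retract₀ k A (compare₀ k A a) = a := by
  rw [compare₀_apply, retract₀_single, toZero_zero, barMap_id, LinearEquiv.apply_symm_apply]

theorem compare₁_apply (t : ⨂[k]^3 A) : compare₁ k A t =
    barSingle₁ k A z012 t - barSingle₁ k A z210 t := rfl

theorem retract₁_compare₁ (t : ⨂[k]^3 A) : retract₁ k A (compare₁ k A t) =
    (LinearMap.range (partialD₂ k A)).mkQ t := by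
  rw [compare₁_apply, map_sub, retract₁_single, retract₁_single, sub_sub_sub_cancel_right]
  have := LinearMap.congr_fun (potential_spec k A (𝟙 (DeltaS.mk 2))) t
  rw [LinearMap.comp_apply, barMap_id] at this
  rw [this, toZero_zero]
  simp

theorem retract₁_catD (x : CatChains (bsym k A) 2) : retract₁ k A (catD (bsym k A) 1 x) = 0 := by
  revert x
  refine LinearMap.congr_fun (f := retract₁ k A ∘ₗ catD (bsym k A) 1) (g := 0) ?_
  refine barChains_hom_ext₂ k A fun X Y Z f g v => ?_
  rw [LinearMap.comp_apply, LinearMap.zero_apply, catD_barSingle₂, map_add, map_sub,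
    retract₁_single, retract₁_single, retract₁_single, potential_naturality, Category.assoc]
  abel

theorem partialD₁_barMap {X : DeltaS} (f : X ⟶ DeltaS.mk 2) :
    partialD₁ k A ∘ₗ barMap k A f = (tensorOne k A).toLinearMap ∘ₗ barMap k A (f ≫ z012) -
      (tensorOne k A).toLinearMap ∘ₗ barMap k A (f ≫ z210) := by
  refine LinearMap.ext fun t => ?_
  simp [partialD₁, barMap_comp]

theorem range_partialD₂_le_ker :
    LinearMap.range (partialD₂ k A) ≤ LinearMap.ker (partialD₁ k A) :=
  range_partialD₂_le_ker_of_increment k A _ fun _ =>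
    ⟨fun f => (tensorOne k A).toLinearMap ∘ₗ barMap k A f, partialD₁_barMap k A⟩

theorem liftQ_partialD₁_retract₁ (y : CatChains (bsym k A) 1) :
    (LinearMap.range (partialD₂ k A)).liftQ (partialD₁ k A) (range_partialD₂_le_ker k A)
      (retract₁ k A y) = retract₀ k A (catD (bsym k A) 0 y) := by
  revert y
  refine LinearMap.congr_fun (f := (LinearMap.range (partialD₂ k A)).liftQ (partialD₁ k A)
    (range_partialD₂_le_ker k A) ∘ₗ retract₁ k A)
    (g := retract₀ k A ∘ₗ catD (bsym k A) 0) ?_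
  refine barChains_hom_ext₁ k A fun X Y f v => ?_
  rw [LinearMap.comp_apply, LinearMap.comp_apply, catD_barSingle₁, map_sub,
    retract₁_single, retract₀_single, retract₀_single, ← barMap_comp]
  refine comp_potential_sub k A _ (fun f => (tensorOne k A).toLinearMap ∘ₗ barMap k A f)
    (fun f => ?_) _ _ v
  rw [← LinearMap.comp_assoc, Submodule.liftQ_mkQ, partialD₁_barMap]

theorem catD_compare₁ (t : ⨂[k]^3 A) :
    catD (bsym k A) 0 (compare₁ k A t) = compare₀ k A (partialD₁ k A t) := by
  rw [compare₁_apply, map_sub, catD_barSingle₁, catD_barSingle₁, sub_sub_sub_cancel_right,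
    ← map_sub]
  rw [compare₀_apply, partialD₁, LinearMap.comp_apply, LinearEquiv.coe_coe,
    LinearEquiv.symm_apply_apply, LinearMap.sub_apply]

/-- Modulo boundaries, a chain on a composite is the sum of the chains on its factors. -/
theorem mk_barSingle₁_comp {X Y Z : DeltaS} (f : X ⟶ Y) (g : Y ⟶ Z) (v : ⨂[k]^(X.n + 1) A) :
    (LinearMap.range (catD (bsym k A) 1)).mkQ (barSingle₁ k A (f ≫ g) v) =
      (LinearMap.range (catD (bsym k A) 1)).mkQ (barSingle₁ k A g (barMap k A f v)) +
      (LinearMap.range (catD (bsym k A) 1)).mkQ (barSingle₁ k A f v) := by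
  have h : (LinearMap.range (catD (bsym k A) 1)).mkQ (catD (bsym k A) 1
      (barSingle₂ k A f g v)) = 0 :=
    (Submodule.Quotient.mk_eq_zero _).2 ⟨_, rfl⟩
  rw [catD_barSingle₂, map_add, map_sub] at h
  rw [eq_comm, ← sub_eq_zero, ← h]
  abel

theorem mk_compare₁_barMap {X : DeltaS} (f : X ⟶ DeltaS.mk 2) :
    ((LinearMap.range (catD (bsym k A) 1)).mkQ ∘ₗ compare₁ k A) ∘ₗ barMap k A f =
      (LinearMap.range (catD (bsym k A) 1)).mkQ ∘ₗ barSingle₁ k A (f ≫ z012) -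
      (LinearMap.range (catD (bsym k A) 1)).mkQ ∘ₗ barSingle₁ k A (f ≫ z210) := by
  refine LinearMap.ext fun v => ?_
  simp only [LinearMap.comp_apply, LinearMap.sub_apply, compare₁_apply, map_sub, mk_barSingle₁_comp]
  abel

theorem range_partialD₂_le_ker_compare₁ : LinearMap.range (partialD₂ k A) ≤
    LinearMap.ker ((LinearMap.range (catD (bsym k A) 1)).mkQ ∘ₗ compare₁ k A) :=
  range_partialD₂_le_ker_of_increment k A _ fun _ =>
    ⟨fun f => (LinearMap.range (catD (bsym k A) 1)).mkQ ∘ₗ barSingle₁ k A f,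
      mk_compare₁_barMap k A⟩

/-- The contraction of the standard complex by the base points `X ⟶ [0]`, in degree zero. -/
def homotopy₀ : CatChains (bsym k A) 0 →ₗ[k] CatChains (bsym k A) 1 :=
  descend₀ fun X => barSingle₁ k A (toZero X)

theorem homotopy₀_single (X : DeltaS) (v : ⨂[k]^(X.n + 1) A) :
    homotopy₀ k A (barSingle₀ k A X v) = barSingle₁ k A (toZero X) v :=
  descend₀_single₀ _ _ _

/-- `compare₁ ∘ retract₁` is homotopic to the identity, modulo boundaries. -/
theorem liftQ_compare₁_retract₁ (y : CatChains (bsym k A) 1) :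
    (LinearMap.range (partialD₂ k A)).liftQ _ (range_partialD₂_le_ker_compare₁ k A)
      (retract₁ k A y) = (LinearMap.range (catD (bsym k A) 1)).mkQ
        (y + homotopy₀ k A (catD (bsym k A) 0 y)) := by
  revert y
  refine LinearMap.congr_fun (f := (LinearMap.range (partialD₂ k A)).liftQ _
    (range_partialD₂_le_ker_compare₁ k A) ∘ₗ retract₁ k A)
    (g := (LinearMap.range (catD (bsym k A) 1)).mkQ ∘ₗ
      (LinearMap.id + homotopy₀ k A ∘ₗ catD (bsym k A) 0)) ?_
  refine barChains_hom_ext₁ k A fun X Y f v => ?_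
  rw [LinearMap.comp_apply, LinearMap.comp_apply, LinearMap.add_apply, LinearMap.id_apply,
    LinearMap.comp_apply, catD_barSingle₁, map_sub, map_add, map_sub, retract₁_single]
  refine (comp_potential_sub k A _
    (fun f => (LinearMap.range (catD (bsym k A) 1)).mkQ ∘ₗ barSingle₁ k A f)
    (fun f => ?_) _ _ v).trans ?_
  · rw [← LinearMap.comp_assoc, Submodule.liftQ_mkQ, mk_compare₁_barMap]
  · rw [LinearMap.comp_apply, LinearMap.comp_apply, mk_barSingle₁_comp, homotopy₀_single,
      homotopy₀_single]
    abel

end Comparison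

/-! ### The isomorphisms in degrees zero and one -/

section Isomorphisms

variable (k A : Type*) [CommRing k] [Ring A] [Algebra k A]

theorem symMk_eq_zero_iff (a : A) : symMk k A a = 0 ↔ a ∈ commutatorIdeal A := by
  rw [← map_zero (symMk k A)]
  refine (RingCon.eq _).trans ?_
  rw [TwoSidedIdeal.rel_iff, sub_zero]

theorem symMk_surjective : Function.Surjective (symMk k A) :=
  RingCon.mkₐ_surjective _

theorem symMk_commute (a b : A) : Commute (symMk k A a) (symMk k A b) := by
  rw [commute_iff_eq, ← map_mul, ← map_mul, ← sub_eq_zero, ← map_sub, symMk_eq_zero_iff]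
  exact TwoSidedIdeal.subset_span ⟨a, b, rfl⟩

/-- The ring `A/([A,A])` is commutative. -/
theorem symQuot_commute (p q : SymQuot A) : Commute p q := by
  obtain ⟨a, rfl⟩ := symMk_surjective ℤ A p
  obtain ⟨b, rfl⟩ := symMk_surjective ℤ A q
  exact symMk_commute ℤ A a b

theorem partialD₁_leftAct (a : A) (t : ⨂[k]^3 A) :
    partialD₁ k A (leftAct k A a t) = a * partialD₁ k A t := by
  revert t
  refine LinearMap.congr_fun (f := partialD₁ k A ∘ₗ leftAct k A a)
    (g := LinearMap.mulLeft k a ∘ₗ partialD₁ k A) ?_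
  refine tensorCube_hom_ext k A fun x y z => ?_
  simp only [LinearMap.comp_apply, LinearMap.mulLeft_apply]
  rw [leftAct_tprod, map_add, map_sub]
  simp only [partialD₁_tprod]
  noncomm_ring

theorem partialD₁_rightAct (a : A) (t : ⨂[k]^3 A) :
    partialD₁ k A (rightAct k A a t) = partialD₁ k A t * a := by
  revert t
  refine LinearMap.congr_fun (f := partialD₁ k A ∘ₗ rightAct k A a)
    (g := LinearMap.mulRight k a ∘ₗ partialD₁ k A) ?_
  refine tensorCube_hom_ext k A fun x y z => ?_
  simp only [LinearMap.comp_apply, LinearMap.mulRight_apply]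
  rw [rightAct_tprod, map_add, map_sub]
  simp only [partialD₁_tprod]
  noncomm_ring

/-- The image of `∂₁` is the ideal `([A,A])`: it is an ideal by `partialD₁_leftAct` and
`partialD₁_rightAct`, and it contains the commutators `ab - ba = ∂₁(a ⊗ b ⊗ 1)`. -/
theorem ker_symMk : LinearMap.ker (symMk k A).toLinearMap = LinearMap.range (partialD₁ k A) := by
  apply le_antisymm
  · intro a ha
    have ha : a ∈ commutatorIdeal A := (symMk_eq_zero_iff k A a).1 ha
    let I : TwoSidedIdeal A := TwoSidedIdeal.mk' (LinearMap.range (partialD₁ k A))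
      (Submodule.zero_mem _) (Submodule.add_mem _) (Submodule.neg_mem _)
      (by rintro x _ ⟨t, rfl⟩; exact ⟨_, partialD₁_leftAct k A x t⟩)
      (by rintro _ x ⟨t, rfl⟩; exact ⟨_, partialD₁_rightAct k A x t⟩)
    have hI : commutatorIdeal A ≤ I := by
      refine TwoSidedIdeal.span_le.2 ?_
      rintro _ ⟨a, b, rfl⟩
      refine (TwoSidedIdeal.mem_mk' _ _ _ _ _ _ _).2
        ⟨PiTensorProduct.tprod k ![a, b, 1], ?_⟩
      rw [partialD₁_tprod, mul_one, one_mul]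
    exact (TwoSidedIdeal.mem_mk' _ _ _ _ _ _ _).1 (hI ha)
  · rw [LinearMap.range_le_ker_iff]
    refine tensorCube_hom_ext k A fun x y z => ?_
    rw [LinearMap.comp_apply, partialD₁_tprod, LinearMap.zero_apply, AlgHom.toLinearMap_apply,
      map_sub, sub_eq_zero, mul_assoc z, map_mul, map_mul _ z,
      (symQuot_commute A (symMk k A z) _).eq, map_mul, map_mul, (symMk_commute k A x y).eq]

/-- The class of `compare₀ a` in `HS₀(A)`. -/
def compare₀Class : A →ₗ[k] HS k A 0 :=
  homologyClass (catD (bsym k A) 0) _ ∘ₗ (compare₀ k A).codRestrict _ fun _ => rfl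

theorem compare₀Class_surjective : Function.Surjective (compare₀Class k A) := by
  have h : (LinearMap.range (catD (bsym k A) 0)).mkQ =
      (LinearMap.range (catD (bsym k A) 0)).mkQ ∘ₗ compare₀ k A ∘ₗ retract₀ k A := by
    refine barChains_hom_ext₀ k A fun X v => ?_
    rw [LinearMap.comp_apply, LinearMap.comp_apply, retract₀_single, compare₀_apply,
      LinearEquiv.symm_apply_apply, ← sub_eq_zero, ← map_sub, ← neg_eq_zero, ← map_neg, neg_sub,
      ← catD_barSingle₁]
    exact (Submodule.Quotient.mk_eq_zero _).2 ⟨_, rfl⟩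
  intro x
  obtain ⟨⟨y, hy⟩, rfl⟩ := Submodule.mkQ_surjective _ x
  refine ⟨retract₀ k A y, ?_⟩
  refine (Submodule.Quotient.eq _).2 ?_
  have := (Submodule.Quotient.eq _).1 (LinearMap.congr_fun h y).symm
  exact this

theorem ker_compare₀Class :
    LinearMap.ker (compare₀Class k A) = LinearMap.range (partialD₁ k A) := by
  ext a
  have h1 : a ∈ LinearMap.ker (compare₀Class k A) ↔
      compare₀ k A a ∈ LinearMap.range (catD (bsym k A) 0) :=
    Submodule.Quotient.mk_eq_zero _
  rw [h1]
  constructor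
  · rintro ⟨y, hy⟩
    obtain ⟨t, ht⟩ := Submodule.mkQ_surjective _ (retract₁ k A y)
    refine ⟨t, ?_⟩
    have := liftQ_partialD₁_retract₁ k A y
    rw [hy, retract₀_compare₀, ← ht] at this
    exact this
  · rintro ⟨t, rfl⟩
    exact ⟨_, catD_compare₁ k A t⟩

theorem compare₁_mem_ker (c : LinearMap.ker (partialD₁ k A)) :
    compare₁ k A c ∈ LinearMap.ker (catDFrom (bsym k A) 1) := by
  refine (catD_compare₁ k A c).trans ?_
  rw [LinearMap.mem_ker.1 c.2, map_zero]

/-- The class of `compare₁ c` in `HS₁(A)`, for a cycle `c` of the partial complex. -/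
def compare₁Class : LinearMap.ker (partialD₁ k A) →ₗ[k] HS k A 1 :=
  homologyClass (catD (bsym k A) 1) _ ∘ₗ
    (compare₁ k A ∘ₗ (LinearMap.ker (partialD₁ k A)).subtype).codRestrict _ (compare₁_mem_ker k A)

theorem compare₁Class_surjective : Function.Surjective (compare₁Class k A) := by
  intro x
  obtain ⟨⟨y, hy⟩, rfl⟩ := Submodule.mkQ_surjective _ x
  have hy : catD (bsym k A) 0 y = 0 := hy
  obtain ⟨t, ht⟩ := Submodule.mkQ_surjective _ (retract₁ k A y)
  have h1 := liftQ_partialD₁_retract₁ k A y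
  have h2 := liftQ_compare₁_retract₁ k A y
  rw [hy, map_zero, ← ht] at h1
  rw [hy, map_zero, add_zero, ← ht] at h2
  refine ⟨⟨t, h1⟩, ?_⟩
  refine (Submodule.Quotient.eq _).2 ?_
  have := (Submodule.Quotient.eq _).1 h2
  exact this

theorem ker_compare₁Class : LinearMap.ker (compare₁Class k A) =
    (LinearMap.range (partialD₂ k A)).submoduleOf (LinearMap.ker (partialD₁ k A)) := by
  ext c
  have h1 : c ∈ LinearMap.ker (compare₁Class k A) ↔
      compare₁ k A c ∈ LinearMap.range (catD (bsym k A) 1) :=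
    Submodule.Quotient.mk_eq_zero _
  rw [h1]
  constructor
  · rintro ⟨y, hy⟩
    have := retract₁_catD k A y
    rw [hy, retract₁_compare₁] at this
    have := (Submodule.Quotient.mk_eq_zero _).1 this
    exact this
  · intro hc
    have := (Submodule.Quotient.mk_eq_zero _).1 (range_partialD₂_le_ker_compare₁ k A hc)
    exact this

/-- The isomorphism `A/([A,A]) ≅ HS₀(A)`: both sides are the quotient of `A` by the image of `∂₁`.
-/
def equivHSZero : SymQuot A ≃ₗ[k] HS k A 0 :=
  ((symMk k A).toLinearMap.quotKerEquivOfSurjective (symMk_surjective k A)).symm ≪≫ₗ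
    Submodule.quotEquivOfEq _ _ ((ker_symMk k A).trans (ker_compare₀Class k A).symm) ≪≫ₗ
    (compare₀Class k A).quotKerEquivOfSurjective (compare₀Class_surjective k A)

theorem equivHSZero_symMk (a : A) : equivHSZero k A (symMk k A a) = compare₀Class k A a := by
  have : ((symMk k A).toLinearMap.quotKerEquivOfSurjective (symMk_surjective k A)).symm
      (symMk k A a) = Submodule.Quotient.mk a := by
    rw [LinearEquiv.symm_apply_eq]; rfl
  rw [equivHSZero, LinearEquiv.trans_apply, LinearEquiv.trans_apply, this]
  rfl

/-- The isomorphism of the first homology of the partial complex with `HS₁(A)`. -/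
def equivHSOne : PartialH₁ k A ≃ₗ[k] HS k A 1 :=
  Submodule.quotEquivOfEq _ _ (ker_compare₁Class k A).symm ≪≫ₗ
    (compare₁Class k A).quotKerEquivOfSurjective (compare₁Class_surjective k A)

theorem equivHSOne_homologyClass (c : LinearMap.ker (partialD₁ k A)) :
    equivHSOne k A (homologyClass (partialD₂ k A) _ c) = compare₁Class k A c := rfl

end Isomorphisms

/-! ### The action of `A/([A,A])` on the first homology -/

section Action

variable (k A : Type*) [CommRing k] [Ring A] [Algebra k A]

/-- The class of `x ⊗ y ⊗ z` modulo the image of `∂₂`. -/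
def tripleClass (x y z : A) : CokerD₂ k A :=
  (LinearMap.range (partialD₂ k A)).mkQ (PiTensorProduct.tprod k ![x, y, z])

/-- For letters with values `v`, the class of a triple of monomials is the increment of a function
of words. An identity between such classes with distinct letters can thus be checked by comparing
the end points of the moves. -/
theorem exists_tripleClass_potential {n : ℕ} (v : Fin n → A) :
    ∃ p : List (Fin n) → CokerD₂ k A, ∀ X Y Z, (X ++ (Y ++ Z)).Perm (List.finRange n) →
      tripleClass k A (X.map v).prod (Y.map v).prod (Z.map v).prod =
        p (X ++ (Y ++ Z)) - p (Z ++ (Y ++ X)) := by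
  refine TripleRel.exists_potential (br := fun X Y Z =>
    tripleClass k A (X.map v).prod (Y.map v).prod (Z.map v).prod) ⟨fun X Y Z W => ?_, fun X => ?_⟩ _
    (List.nodup_finRange n)
  · have := mk_partialD₂Fst k A (PiTensorProduct.tprod k
      ![(X.map v).prod, (Y.map v).prod, (Z.map v).prod, (W.map v).prod])
    rw [partialD₂Fst_tprod, map_add, map_add, map_add] at this
    simpa [tripleClass, mul_assoc] using this
  · have := mk_partialD₂Snd k A (X.map v).prod
    rw [partialD₂Snd_apply] at this
    simpa [tripleClass] using this

theorem mk_leftAct_tprod (a x y z : A) :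
    (LinearMap.range (partialD₂ k A)).mkQ
      (leftAct k A a (PiTensorProduct.tprod k ![x, y, z])) =
    tripleClass k A (a * x) y z - tripleClass k A x (y * a) z + tripleClass k A x y (a * z) := by
  rw [leftAct_tprod, map_add, map_sub]; rfl

theorem mk_rightAct_tprod (a x y z : A) :
    (LinearMap.range (partialD₂ k A)).mkQ
      (rightAct k A a (PiTensorProduct.tprod k ![x, y, z])) =
    tripleClass k A (x * a) y z - tripleClass k A x (a * y) z + tripleClass k A x y (z * a) := by
  rw [rightAct_tprod, map_add, map_sub]; rfl

theorem leftAct_mem_ker (a : A) (c : LinearMap.ker (partialD₁ k A)) :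
    leftAct k A a c ∈ LinearMap.ker (partialD₁ k A) := by
  rw [LinearMap.mem_ker, partialD₁_leftAct, LinearMap.mem_ker.1 c.2, mul_zero]

theorem rightAct_mem_ker (a : A) (c : LinearMap.ker (partialD₁ k A)) :
    rightAct k A a c ∈ LinearMap.ker (partialD₁ k A) := by
  rw [LinearMap.mem_ker, partialD₁_rightAct, LinearMap.mem_ker.1 c.2, zero_mul]

/-- The operator `λ_l` turns the move `X Y Z ↦ Z Y X` into the move `L X Y Z ↦ L Z Y X`, where `l`
is the value of the word `L`. -/
theorem mk_leftAct_of_letters {n : ℕ} {v : Fin n → A} {p : List (Fin n) → CokerD₂ k A}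
    (hp : ∀ X Y Z, (X ++ (Y ++ Z)).Perm (List.finRange n) →
      tripleClass k A (X.map v).prod (Y.map v).prod (Z.map v).prod =
        p (X ++ (Y ++ Z)) - p (Z ++ (Y ++ X))) (L X Y Z : List (Fin n))
    (h : (L ++ (X ++ (Y ++ Z))).Perm (List.finRange n)) :
    (LinearMap.range (partialD₂ k A)).mkQ (leftAct k A (L.map v).prod
      (PiTensorProduct.tprod k ![(X.map v).prod, (Y.map v).prod, (Z.map v).prod])) =
    p (L ++ (X ++ (Y ++ Z))) - p (L ++ (Z ++ (Y ++ X))) := by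
  have h1 := hp (L ++ X) Y Z (by simpa using h)
  have h2 := hp X (Y ++ L) Z (List.perm_iff_count.2 fun a => by
    rw [← List.perm_iff_count.1 h a]; simp only [List.count_append]; omega)
  have h3 := hp X Y (L ++ Z) (List.perm_iff_count.2 fun a => by
    rw [← List.perm_iff_count.1 h a]; simp only [List.count_append]; omega)
  simp only [List.map_append, List.prod_append, List.append_assoc] at h1 h2 h3
  rw [mk_leftAct_tprod, h1, h2, h3]
  abel

theorem range_partialD₂_le_comap_leftAct (a : A) : LinearMap.range (partialD₂ k A) ≤
    (LinearMap.range (partialD₂ k A)).comap (leftAct k A a) := by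
  refine range_partialD₂_le k A (fun t => ?_) (fun b => ?_)
  · rw [Submodule.mem_comap, ← Submodule.Quotient.mk_eq_zero, ← Submodule.mkQ_apply]
    revert t
    refine LinearMap.congr_fun (f := (LinearMap.range (partialD₂ k A)).mkQ ∘ₗ
      leftAct k A a ∘ₗ partialD₂Fst k A) (g := 0) ?_
    refine tensorPower_hom_ext k A fun v => ?_
    have hv : v = ![v 0, v 1, v 2, v 3] := by funext i; fin_cases i <;> rfl
    obtain ⟨p, hp⟩ := exists_tripleClass_potential k A ![a, v 0, v 1, v 2, v 3]
    have h1 := mk_leftAct_of_letters k A hp [0] [1, 2] [3] [4] (by decide)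
    have h2 := mk_leftAct_of_letters k A hp [0] [4] [3, 1] [2] (by decide)
    have h3 := mk_leftAct_of_letters k A hp [0] [2, 3, 1] [] [4] (by decide)
    have h4 := mk_leftAct_of_letters k A hp [0] [4] [2, 3] [1] (by decide)
    rw [LinearMap.comp_apply, LinearMap.comp_apply, hv, partialD₂Fst_tprod]
    simp only [map_add]
    simp [- Submodule.mkQ_apply, - map_add] at h1 h2 h3 h4
    simp only [mul_assoc]
    rw [h1, h2, h3, h4]
    simp
  · rw [Submodule.mem_comap, ← Submodule.Quotient.mk_eq_zero, ← Submodule.mkQ_apply,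
      partialD₂Snd_apply]
    obtain ⟨p, hp⟩ := exists_tripleClass_potential k A ![a, b]
    have h1 := mk_leftAct_of_letters k A hp [0] [] [1] [] (by decide)
    simpa [- Submodule.mkQ_apply] using h1

theorem update_fst {B : Type*} (x y z w : B) : Function.update ![x, y, z] 0 w = ![w, y, z] := by
  funext i; fin_cases i <;> rfl

theorem update_snd {B : Type*} (x y z w : B) : Function.update ![x, y, z] 1 w = ![x, w, z] := by
  funext i; fin_cases i <;> rfl

theorem update_trd {B : Type*} (x y z w : B) : Function.update ![x, y, z] 2 w = ![x, y, w] := by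
  funext i; fin_cases i <;> rfl

theorem leftAct_add (a b : A) : leftAct k A (a + b) = leftAct k A a + leftAct k A b := by
  refine tensorCube_hom_ext k A fun x y z => ?_
  have h := fun i => (PiTensorProduct.tprod k (s := fun _ : Fin 3 => A)).map_update_add ![x, y, z] i
  have h0 := h 0 (a * x) (b * x)
  have h1 := h 1 (y * a) (y * b)
  have h2 := h 2 (a * z) (b * z)
  simp only [update_fst, update_snd, update_trd] at h0 h1 h2
  rw [LinearMap.add_apply, leftAct_tprod, leftAct_tprod, leftAct_tprod, add_mul, mul_add, add_mul,
    h0, h1, h2]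
  abel

theorem leftAct_smul (r : k) (a : A) : leftAct k A (r • a) = r • leftAct k A a := by
  refine tensorCube_hom_ext k A fun x y z => ?_
  have h := fun i =>
    (PiTensorProduct.tprod k (s := fun _ : Fin 3 => A)).map_update_smul ![x, y, z] i
  have h0 := h 0 r (a * x)
  have h1 := h 1 r (y * a)
  have h2 := h 2 r (a * z)
  simp only [update_fst, update_snd, update_trd] at h0 h1 h2
  rw [LinearMap.smul_apply, leftAct_tprod, leftAct_tprod, smul_mul_assoc, mul_smul_comm,
    smul_mul_assoc, h0, h1, h2, smul_add, smul_sub]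

theorem leftAct_one : leftAct k A 1 = LinearMap.id := by
  refine tensorCube_hom_ext k A fun x y z => ?_
  rw [leftAct_tprod]
  simp

theorem mk_leftAct_mul (a b : A) (t : ⨂[k]^3 A) :
    (LinearMap.range (partialD₂ k A)).mkQ (leftAct k A (a * b) t) =
      (LinearMap.range (partialD₂ k A)).mkQ (leftAct k A a (leftAct k A b t)) := by
  revert t
  refine LinearMap.congr_fun (f := (LinearMap.range (partialD₂ k A)).mkQ ∘ₗ leftAct k A (a * b))
    (g := (LinearMap.range (partialD₂ k A)).mkQ ∘ₗ leftAct k A a ∘ₗ leftAct k A b) ?_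
  refine tensorCube_hom_ext k A fun x y z => ?_
  obtain ⟨p, hp⟩ := exists_tripleClass_potential k A ![a, b, x, y, z]
  have h0 := mk_leftAct_of_letters k A hp [0, 1] [2] [3] [4] (by decide)
  have h1 := mk_leftAct_of_letters k A hp [0] [1, 2] [3] [4] (by decide)
  have h2 := mk_leftAct_of_letters k A hp [0] [2] [3, 1] [4] (by decide)
  have h3 := mk_leftAct_of_letters k A hp [0] [2] [3] [1, 4] (by decide)
  simp [- Submodule.mkQ_apply] at h0 h1 h2 h3
  rw [LinearMap.comp_apply, LinearMap.comp_apply, LinearMap.comp_apply, leftAct_tprod k A b]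
  simp only [map_add, map_sub]
  rw [h0, h1, h2, h3]
  abel

/-- The moves `a X Y Z ↦ a Z Y X` and `X Y Z a ↦ Z Y X a` differ by rotations, so `λ_a - ρ_a`
factors through `∂₁` modulo the image of `∂₂`. -/
theorem mk_leftAct_sub_rightAct (a : A) (t : ⨂[k]^3 A) :
    (LinearMap.range (partialD₂ k A)).mkQ (leftAct k A a t - rightAct k A a t) =
      (LinearMap.range (partialD₂ k A)).mkQ
        ((PiTensorProduct.tprod k).toLinearMap ![a, 1, 0] 2 (partialD₁ k A t)) := by
  revert t
  refine LinearMap.congr_fun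
    (f := (LinearMap.range (partialD₂ k A)).mkQ ∘ₗ (leftAct k A a - rightAct k A a))
    (g := (LinearMap.range (partialD₂ k A)).mkQ ∘ₗ
      (PiTensorProduct.tprod k (s := fun _ : Fin 3 => A)).toLinearMap ![a, 1, 0] 2 ∘ₗ
        partialD₁ k A) ?_
  refine tensorCube_hom_ext k A fun x y z => ?_
  obtain ⟨p, hp⟩ := exists_tripleClass_potential k A ![a, x, y, z]
  have h0 := mk_leftAct_of_letters k A hp [0] [1] [2] [3] (by decide)
  have h1 := hp [1, 0] [2] [3] (by decide)
  have h2 := hp [1] [0, 2] [3] (by decide)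
  have h3 := hp [1] [2] [3, 0] (by decide)
  have h4 := hp [0] [] [1, 2, 3] (by decide)
  have h5 := hp [0] [] [3, 2, 1] (by decide)
  simp [- Submodule.mkQ_apply] at h0 h1 h2 h3 h4 h5
  have e : ∀ w, (PiTensorProduct.tprod k (s := fun _ : Fin 3 => A)).toLinearMap ![a, 1, 0] 2 w =
      PiTensorProduct.tprod k ![a, 1, w] := fun w => by
    rw [MultilinearMap.toLinearMap_apply, update_trd]
  simp only [LinearMap.comp_apply, LinearMap.sub_apply, map_sub]
  rw [h0, mk_rightAct_tprod, h1, h2, h3, partialD₁_tprod, map_sub, map_sub, e, e]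
  change _ = tripleClass k A _ _ _ - tripleClass k A _ _ _
  rw [mul_assoc, mul_assoc, h4, h5]
  abel

/-- The moves `a b X Y Z ↦ a b Z Y X` and `b a X Y Z ↦ b a Z Y X` differ by moves that do not
separate the letters of `X Y Z` and of `Z Y X`, so `λ_{ab} - λ_{ba}` factors through `∂₁` modulo
the image of `∂₂`. -/
theorem mk_leftAct_commutator (a b : A) (t : ⨂[k]^3 A) :
    (LinearMap.range (partialD₂ k A)).mkQ (leftAct k A (a * b) t - leftAct k A (b * a) t) =
      (LinearMap.range (partialD₂ k A)).mkQ
        ((PiTensorProduct.tprod k).toLinearMap ![a, b, 0] 2 (partialD₁ k A t) +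
          (PiTensorProduct.tprod k).toLinearMap ![0, 1, b * a] 0 (partialD₁ k A t)) := by
  revert t
  refine LinearMap.congr_fun
    (f := (LinearMap.range (partialD₂ k A)).mkQ ∘ₗ (leftAct k A (a * b) - leftAct k A (b * a)))
    (g := (LinearMap.range (partialD₂ k A)).mkQ ∘ₗ
      ((PiTensorProduct.tprod k (s := fun _ : Fin 3 => A)).toLinearMap ![a, b, 0] 2 +
        (PiTensorProduct.tprod k (s := fun _ : Fin 3 => A)).toLinearMap ![0, 1, b * a] 0) ∘ₗ
        partialD₁ k A) ?_
  refine tensorCube_hom_ext k A fun x y z => ?_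
  obtain ⟨p, hp⟩ := exists_tripleClass_potential k A ![a, b, x, y, z]
  have h0 := mk_leftAct_of_letters k A hp [0, 1] [2] [3] [4] (by decide)
  have h1 := mk_leftAct_of_letters k A hp [1, 0] [2] [3] [4] (by decide)
  have h2 := hp [0] [1] [2, 3, 4] (by decide)
  have h3 := hp [0] [1] [4, 3, 2] (by decide)
  have h4 := hp [2, 3, 4] [] [1, 0] (by decide)
  have h5 := hp [4, 3, 2] [] [1, 0] (by decide)
  simp [- Submodule.mkQ_apply] at h0 h1 h2 h3 h4 h5
  have e : ∀ w, (PiTensorProduct.tprod k (s := fun _ : Fin 3 => A)).toLinearMap ![a, b, 0] 2 w =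
      PiTensorProduct.tprod k ![a, b, w] := fun w => by
    rw [MultilinearMap.toLinearMap_apply, update_trd]
  have e' : ∀ w,
      (PiTensorProduct.tprod k (s := fun _ : Fin 3 => A)).toLinearMap ![0, 1, b * a] 0 w =
        PiTensorProduct.tprod k ![w, 1, b * a] := fun w => by
    rw [MultilinearMap.toLinearMap_apply, update_fst]
  simp only [LinearMap.comp_apply, LinearMap.sub_apply, LinearMap.add_apply, map_sub, map_add]
  rw [h0, h1, partialD₁_tprod, map_sub, map_sub, map_sub, map_sub, e, e, e', e']
  change _ = tripleClass k A _ _ _ - tripleClass k A _ _ _ +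
    (tripleClass k A _ _ _ - tripleClass k A _ _ _)
  rw [mul_assoc, mul_assoc, h2, h3, h4, h5]
  abel

/-- The endomorphism of the first homology of the partial complex induced by `λ_a`. -/
def actH (a : A) : Module.End k (PartialH₁ k A) :=
  Submodule.mapQ _ _ ((leftAct k A a).restrict fun c hc => leftAct_mem_ker k A a ⟨c, hc⟩)
    fun _ hc => range_partialD₂_le_comap_leftAct k A a hc

theorem actH_homologyClass (a : A) (c : LinearMap.ker (partialD₁ k A)) :
    actH k A a (homologyClass (partialD₂ k A) _ c) =
      homologyClass (partialD₂ k A) _ ⟨leftAct k A a c, leftAct_mem_ker k A a c⟩ := rfl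

theorem homologyClass_eq_iff (c c' : LinearMap.ker (partialD₁ k A)) :
    homologyClass (partialD₂ k A) (partialD₁ k A) c = homologyClass (partialD₂ k A) _ c' ↔
      (LinearMap.range (partialD₂ k A)).mkQ c.1 = (LinearMap.range (partialD₂ k A)).mkQ c'.1 := by
  refine (Submodule.Quotient.eq _).trans ?_
  rw [Submodule.mkQ_apply, Submodule.mkQ_apply, Submodule.Quotient.eq]
  rfl

theorem actH_ext {φ ψ : Module.End k (PartialH₁ k A)}
    (h : ∀ c, φ (homologyClass (partialD₂ k A) (partialD₁ k A) c) =
      ψ (homologyClass (partialD₂ k A) (partialD₁ k A) c)) : φ = ψ :=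
  LinearMap.ext fun x => by
    obtain ⟨c, rfl⟩ := Submodule.mkQ_surjective _ x
    exact h c

/-- The operators induced by `λ_a` form a representation of `A`. -/
def actHom : A →ₐ[k] Module.End k (PartialH₁ k A) :=
  AlgHom.ofLinearMap
    { toFun := actH k A
      map_add' := fun a b => actH_ext k A fun c => by
        rw [LinearMap.add_apply]
        simp only [actH_homologyClass, leftAct_add]
        rfl
      map_smul' := fun r a => actH_ext k A fun c => by
        rw [LinearMap.smul_apply]
        simp only [actH_homologyClass, leftAct_smul]
        rfl }
    (actH_ext k A fun c => by
      refine (actH_homologyClass k A 1 c).trans ?_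
      simp only [leftAct_one]
      rfl)
    (fun a b => actH_ext k A fun c => by
      refine (actH_homologyClass k A (a * b) c).trans ?_
      refine (homologyClass_eq_iff k A _ _).2 ?_
      exact mk_leftAct_mul k A a b c)

theorem actHom_homologyClass (a : A) (c : LinearMap.ker (partialD₁ k A)) :
    actHom k A a (homologyClass (partialD₂ k A) _ c) =
      homologyClass (partialD₂ k A) _ ⟨leftAct k A a c, leftAct_mem_ker k A a c⟩ := rfl

theorem actHom_commute (a b : A) : actHom k A (a * b) = actHom k A (b * a) :=
  actH_ext k A fun c => by
    rw [actHom_homologyClass, actHom_homologyClass, homologyClass_eq_iff, ← sub_eq_zero, ← map_sub,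
      mk_leftAct_commutator, LinearMap.mem_ker.1 c.2]
    simp only [map_zero, add_zero]

theorem commutatorIdeal_le_ker_actHom :
    commutatorIdeal A ≤ TwoSidedIdeal.ker (actHom k A) := by
  refine TwoSidedIdeal.span_le.2 ?_
  rintro _ ⟨a, b, rfl⟩
  refine (TwoSidedIdeal.mem_ker _).2 ?_
  rw [map_sub, actHom_commute, sub_self]

/-- The representation of `A/([A,A])` on `HS₁(A)` induced by the operators `λ_a`. -/
def symQuotAct : SymQuot A →ₐ[k] Module.End k (HS k A 1) :=
  (((equivHSOne k A).conjAlgEquiv k).toAlgHom.comp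
    ((commutatorIdeal A).ringCon.liftₐ (actHom k A) fun a b h => by
      have h1 := (TwoSidedIdeal.rel_iff _ _ _).1 h
      have h2 := (TwoSidedIdeal.mem_ker _).1 (commutatorIdeal_le_ker_actHom k A h1)
      rw [map_sub, sub_eq_zero] at h2
      exact h2))

theorem symQuotAct_symMk (a : A) (x : PartialH₁ k A) :
    symQuotAct k A (symMk k A a) (equivHSOne k A x) = equivHSOne k A (actHom k A a x) := by
  change equivHSOne k A (actHom k A a ((equivHSOne k A).symm (equivHSOne k A x))) = _
  rw [LinearEquiv.symm_apply_apply]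

theorem homologyClass_leftAct_eq_rightAct (a : A) (c : LinearMap.ker (partialD₁ k A)) :
    homologyClass (partialD₂ k A) (partialD₁ k A) ⟨leftAct k A a c, leftAct_mem_ker k A a c⟩ =
      homologyClass (partialD₂ k A) _ ⟨rightAct k A a c, rightAct_mem_ker k A a c⟩ := by
  rw [homologyClass_eq_iff, ← sub_eq_zero, ← map_sub, mk_leftAct_sub_rightAct,
    LinearMap.mem_ker.1 c.2, map_zero, map_zero]

end Action

end SymHom

end

theorem mainTheorem5 (k A : Type*) [CommRing k] [Ring A] [Algebra k A] :
    ∃ (e₀ : SymHom.SymQuot A ≃ₗ[k] SymHom.HS k A 0)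
      (e₁ : SymHom.PartialH₁ k A ≃ₗ[k] SymHom.HS k A 1),
      (∀ a : A, ∃ h : SymHom.compare₀ k A a ∈ LinearMap.ker (SymHom.catDFrom (SymHom.bsym k A) 0),
        e₀ (SymHom.symMk k A a) =
          SymHom.homologyClass (SymHom.catD (SymHom.bsym k A) 0) _ ⟨SymHom.compare₀ k A a, h⟩) ∧
      (∀ c : LinearMap.ker (SymHom.partialD₁ k A),
        ∃ h : SymHom.compare₁ k A c ∈ LinearMap.ker (SymHom.catDFrom (SymHom.bsym k A) 1),
          e₁ (SymHom.homologyClass (SymHom.partialD₂ k A) _ c) =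
            SymHom.homologyClass (SymHom.catD (SymHom.bsym k A) 1) _
              ⟨SymHom.compare₁ k A c, h⟩) ∧
      ∃ (_ : Module (SymHom.SymQuot A) (SymHom.HS k A 1))
        (_ : Module (SymHom.SymQuot A)ᵐᵒᵖ (SymHom.HS k A 1)),
        IsScalarTower k (SymHom.SymQuot A) (SymHom.HS k A 1) ∧
        IsScalarTower k (SymHom.SymQuot A)ᵐᵒᵖ (SymHom.HS k A 1) ∧
        (∀ (a : A) (c : LinearMap.ker (SymHom.partialD₁ k A)),
          ∃ h : SymHom.leftAct k A a c ∈ LinearMap.ker (SymHom.partialD₁ k A),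
            SymHom.symMk k A a • e₁ (SymHom.homologyClass (SymHom.partialD₂ k A) _ c) =
              e₁ (SymHom.homologyClass (SymHom.partialD₂ k A) _ ⟨SymHom.leftAct k A a c, h⟩)) ∧
        (∀ (a : A) (c : LinearMap.ker (SymHom.partialD₁ k A)),
          ∃ h : SymHom.rightAct k A a c ∈ LinearMap.ker (SymHom.partialD₁ k A),
            MulOpposite.op (SymHom.symMk k A a) •
                e₁ (SymHom.homologyClass (SymHom.partialD₂ k A) _ c) =
              e₁ (SymHom.homologyClass (SymHom.partialD₂ k A) _ ⟨SymHom.rightAct k A a c, h⟩)) ∧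
        ∀ (q : SymHom.SymQuot A) (x : SymHom.HS k A 1), q • x = MulOpposite.op q • x := by
  let m₁ : Module (SymHom.SymQuot A) (SymHom.HS k A 1) :=
    Module.compHom _ (SymHom.symQuotAct k A).toRingHom
  let m₂ : Module (SymHom.SymQuot A)ᵐᵒᵖ (SymHom.HS k A 1) :=
    Module.compHom _ ((SymHom.symQuotAct k A).toRingHom.fromOpposite fun p q =>
      (SymHom.symQuot_commute A p q).map (SymHom.symQuotAct k A))
  refine ⟨SymHom.equivHSZero k A, SymHom.equivHSOne k A,
    fun a => ⟨rfl, SymHom.equivHSZero_symMk k A a⟩,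
    fun c => ⟨SymHom.compare₁_mem_ker k A c, SymHom.equivHSOne_homologyClass k A c⟩,
    m₁, m₂, ⟨fun r q x => ?_⟩, ⟨fun r q x => ?_⟩,
    fun a c => ⟨SymHom.leftAct_mem_ker k A a c, ?_⟩,
    fun a c => ⟨SymHom.rightAct_mem_ker k A a c, ?_⟩, fun q x => rfl⟩
  · exact LinearMap.congr_fun (map_smul (SymHom.symQuotAct k A) r q) x
  · exact LinearMap.congr_fun (map_smul (SymHom.symQuotAct k A) r q.unop) x
  · exact SymHom.symQuotAct_symMk k A a _
  · refine (SymHom.symQuotAct_symMk k A a _).trans (congrArg _ ?_)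
    exact SymHom.homologyClass_leftAct_eq_rightAct k A a c
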